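/- **Conventions.** Graphs are finite, simple and undirected, and C*-algebras are unital. A *magic unitary* is a square matrix over a C*-algebra whose entries are projections and all of whose rows and columns consist of pairwise orthogonal projections with sum $1$. A *quantum permutation group* is a pair $(A,u)$, where $u=(u_{ij})$ is a magic unitary whose entries generate the C*-algebra $A$, such that there are morphisms $\Delta:A\to A\otimes A$, $\varepsilon:A\to\mathbb C$, $S:A\to A^{op}$ with $\Delta(u_{ij})=\sum_k u_{ik}\otimes u_{kj}$, $\varepsilon(u_{ij})=\delta_{ij}$, $S(u_{ij})=u_{ji}$, making $A$ a Hopf C*-algebra (here $\otimes$ is the maximal C*-tensor product). For a graph $X$ with adjacency matrix $d_X$, $A(X)$ is the universal C*-algebra generated by the entries of a magic unitary $u$, indexed by the vertices of $X$, with $u d_X=d_X u$; together with $u$ it is a quantum permutation group. The lexicographic product $X\circ Y$ of two graphs has vertex set $X\times Y$ and edges $(i,\alpha)\sim(j,\beta)$ if and only if $\alpha\sim\beta$, or $\alpha=\beta$ and $i\sim j$. The free wreath product of $(A,u)$ and $(B,v)$, with $u$ of nonzero size and $v$ of size $m$, is $A*_wB=(A^{*m}*B)/\langle [u^{(a)}_{ij},v_{ab}]=0\rangle$,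 where $u^{(a)}$ is the copy of $u$ in the $a$-th copy of $A$, with the magic unitary $w_{ia,jb}=u^{(a)}_{ij}v_{ab}$; it is a quantum permutation group. **Theorem 6.2.** Let $X$ and $Y$ be regular graphs with $X$ connected, and let $n$ and $\lambda_1$ be the order and the valence of $X$. Let $\{\lambda_i\}$ be the set of (distinct) eigenvalues of $d_X$, and $\{\mu_j\}$ the set of eigenvalues of $d_Y$. If $$\{\lambda_1-\lambda_i \mid i\neq 1\}\cap\{-n\mu_j\}=\emptyset,$$ then $A(X\circ Y)=A(X)*_wA(Y)$; that is, there is an isomorphism of C*-algebras $A(X\circ Y)\to A(X)*_wA(Y)$ which maps each entry of the magic unitary of $A(X\circ Y)$ to the corresponding entry of the magic unitary $w$ of $A(X)*_wA(Y)$, and which is compatible with the comultiplications, counits and antipodes. -/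

import Mathlib

noncomputable section

open scoped CStarAlgebra

namespace QAut

set_option linter.unusedSectionVars false

/-! ### Universal unital C*-algebras -/

/-- Formal noncommutative `*`-polynomials with complex coefficients in the letters `G`. -/
inductive StarPoly (G : Type) : Type
  | gen (g : G) : StarPoly G
  | scalar (c : ℂ) : StarPoly G
  | plus (s t : StarPoly G) : StarPoly G
  | times (s t : StarPoly G) : StarPoly G
  | adj (s : StarPoly G) : StarPoly G

/-- The value of a `*`-polynomial at a family of elements of a unital C*-algebra. -/
def StarPoly.eval {G A : Type} [CStarAlgebra A] (π : G → A) : StarPoly G → A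
  | gen g => π g
  | scalar c => algebraMap ℂ A c
  | plus s t => s.eval π + t.eval π
  | times s t => s.eval π * t.eval π
  | adj s => star (s.eval π)

/-- A system of relations between generators `G`: a condition on families `G → A` in unital
C*-algebras `A` which bounds the norm of each member of the family by a constant that does not
depend on `A`. -/
structure Relations (G : Type) where
  Holds : ∀ {A : Type} [CStarAlgebra A], (G → A) → Prop
  bound : G → ℝ
  norm_le : ∀ {A : Type} [CStarAlgebra A] (π : G → A), Holds π → ∀ g, ‖π g‖ ≤ bound g

namespace Relations

variable {G : Type} (R : Relations G)

/-- Two `*`-polynomials are identified if they agree on all families satisfying the relations. -/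
def setoid : Setoid (StarPoly G) where
  r s t := ∀ (A : Type) [CStarAlgebra A] (π : G → A), R.Holds π → s.eval π = t.eval π
  iseqv := ⟨fun _ _ _ _ _ => rfl, fun h A _ π hπ => (h A π hπ).symm,
    fun h h' A _ π hπ => (h A π hπ).trans (h' A π hπ)⟩

/-- The `*`-algebra of `*`-polynomials in generators subject to the relations `R`. -/
def Pre : Type := Quotient R.setoid

namespace Pre

/-- Evaluation, as a function. -/
def ev {A : Type} [CStarAlgebra A] (π : G → A) (hπ : R.Holds π) : R.Pre → A :=
  Quotient.lift (fun s => s.eval π) (fun _ _ h => h A π hπ)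

variable {R} in
theorem ext' {x y : R.Pre}
    (h : ∀ (A : Type) [CStarAlgebra A] (π : G → A) (hπ : R.Holds π), ev R π hπ x = ev R π hπ y) :
    x = y := by
  induction x using Quotient.inductionOn with | _ s
  induction y using Quotient.inductionOn with | _ t
  exact Quotient.sound (fun A _ π hπ => h A π hπ)

instance : Zero R.Pre := ⟨Quotient.mk _ (.scalar 0)⟩
instance : One R.Pre := ⟨Quotient.mk _ (.scalar 1)⟩
instance : Add R.Pre := ⟨Quotient.map₂ .plus (fun _ _ h _ _ h' A _ π hπ => by
  simp only [StarPoly.eval, h A π hπ, h' A π hπ])⟩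
instance : Mul R.Pre := ⟨Quotient.map₂ .times (fun _ _ h _ _ h' A _ π hπ => by
  simp only [StarPoly.eval, h A π hπ, h' A π hπ])⟩
instance : Star R.Pre := ⟨Quotient.map .adj (fun _ _ h A _ π hπ => by
  simp only [StarPoly.eval, h A π hπ])⟩
instance : SMul ℂ R.Pre := ⟨fun c => Quotient.map (.times (.scalar c)) (fun _ _ h A _ π hπ => by
  simp only [StarPoly.eval, h A π hπ])⟩
instance : Neg R.Pre := ⟨fun x => (-1 : ℂ) • x⟩

section

variable {A : Type} [CStarAlgebra A] (π : G → A) (hπ : R.Holds π)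

@[simp] theorem ev_zero : ev R π hπ 0 = 0 := map_zero (algebraMap ℂ A)
@[simp] theorem ev_one : ev R π hπ 1 = 1 := map_one (algebraMap ℂ A)
@[simp] theorem ev_add (x y : R.Pre) : ev R π hπ (x + y) = ev R π hπ x + ev R π hπ y := by
  induction x using Quotient.inductionOn with | _ s
  induction y using Quotient.inductionOn with | _ t
  rfl
@[simp] theorem ev_mul (x y : R.Pre) : ev R π hπ (x * y) = ev R π hπ x * ev R π hπ y := by
  induction x using Quotient.inductionOn with | _ s
  induction y using Quotient.inductionOn with | _ t
  rfl
@[simp] theorem ev_star (x : R.Pre) : ev R π hπ (star x) = star (ev R π hπ x) := by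
  induction x using Quotient.inductionOn with | _ s
  rfl
@[simp] theorem ev_smul (c : ℂ) (x : R.Pre) : ev R π hπ (c • x) = c • ev R π hπ x := by
  induction x using Quotient.inductionOn with | _ s
  exact (Algebra.smul_def c _).symm
@[simp] theorem ev_neg (x : R.Pre) : ev R π hπ (-x) = - ev R π hπ x := by
  change ev R π hπ ((-1 : ℂ) • x) = _
  simp

end

instance : Ring R.Pre where
  add_assoc x y z := ext' fun A _ π hπ => by simp [add_assoc]
  zero_add x := ext' fun A _ π hπ => by simp
  add_zero x := ext' fun A _ π hπ => by simp
  add_comm x y := ext' fun A _ π hπ => by simp [add_comm]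
  left_distrib x y z := ext' fun A _ π hπ => by simp [mul_add]
  right_distrib x y z := ext' fun A _ π hπ => by simp [add_mul]
  zero_mul x := ext' fun A _ π hπ => by simp
  mul_zero x := ext' fun A _ π hπ => by simp
  mul_assoc x y z := ext' fun A _ π hπ => by simp [mul_assoc]
  one_mul x := ext' fun A _ π hπ => by simp
  mul_one x := ext' fun A _ π hπ => by simp
  neg_add_cancel x := ext' fun A _ π hπ => by simp
  nsmul := nsmulRec
  zsmul := zsmulRec

instance : StarRing R.Pre where
  star_involutive x := ext' fun A _ π hπ => by simp
  star_mul x y := ext' fun A _ π hπ => by simp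
  star_add x y := ext' fun A _ π hπ => by simp

instance : Module ℂ R.Pre where
  one_smul x := ext' fun A _ π hπ => by simp
  mul_smul c d x := ext' fun A _ π hπ => by simp [mul_smul]
  smul_zero c := ext' fun A _ π hπ => by simp
  smul_add c x y := ext' fun A _ π hπ => by simp
  add_smul c d x := ext' fun A _ π hπ => by simp [add_smul]
  zero_smul x := ext' fun A _ π hπ => by simp

instance : Algebra ℂ R.Pre :=
  Algebra.ofModule (fun c x y => ext' fun A _ π hπ => by simp)
    (fun c x y => ext' fun A _ π hπ => by simp)

instance : StarModule ℂ R.Pre where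
  star_smul c x := ext' fun A _ π hπ => by simp

/-- Evaluation at a family satisfying the relations, as a `*`-homomorphism. -/
def evHom {A : Type} [CStarAlgebra A] (π : G → A) (hπ : R.Holds π) : R.Pre →⋆ₐ[ℂ] A where
  toFun := ev R π hπ
  map_one' := ev_one R π hπ
  map_mul' := ev_mul R π hπ
  map_zero' := ev_zero R π hπ
  map_add' := ev_add R π hπ
  commutes' c := by
    rw [Algebra.algebraMap_eq_smul_one, Algebra.algebraMap_eq_smul_one, ev_smul, ev_one]
  map_star' := ev_star R π hπ

/-- The values `‖π(x)‖`, over all families `π` satisfying the relations. -/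
def normSet (x : R.Pre) : Set ℝ :=
  {r | ∃ (A : Type) (_ : CStarAlgebra A) (π : G → A) (hπ : R.Holds π), r = ‖ev R π hπ x‖}

theorem norm_scalar_le {A : Type} [CStarAlgebra A] (c : ℂ) : ‖algebraMap ℂ A c‖ ≤ ‖c‖ := by
  rcases subsingleton_or_nontrivial A with h | h
  · rw [Subsingleton.elim (algebraMap ℂ A c) 0, norm_zero]
    exact norm_nonneg c
  · exact (norm_algebraMap' A c).le

theorem bddAbove_normSet (x : R.Pre) : BddAbove (normSet R x) := by
  induction x using Quotient.inductionOn with | _ s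
  suffices h : ∃ C : ℝ, 0 ≤ C ∧ ∀ (A : Type) [CStarAlgebra A] (π : G → A), R.Holds π →
      ‖s.eval π‖ ≤ C by
    obtain ⟨C, -, hC⟩ := h
    refine ⟨C, ?_⟩
    rintro r ⟨A, _, π, hπ, rfl⟩
    exact hC A π hπ
  induction s with
  | gen g => exact ⟨max 0 (R.bound g), le_max_left _ _, fun A _ π hπ =>
      (R.norm_le π hπ g).trans (le_max_right _ _)⟩
  | scalar c => exact ⟨‖c‖, norm_nonneg c, fun A _ π hπ => norm_scalar_le c⟩
  | plus s t hs ht =>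
    obtain ⟨C, hC0, hC⟩ := hs
    obtain ⟨D, hD0, hD⟩ := ht
    exact ⟨C + D, add_nonneg hC0 hD0, fun A _ π hπ =>
      (norm_add_le _ _).trans (add_le_add (hC A π hπ) (hD A π hπ))⟩
  | times s t hs ht =>
    obtain ⟨C, hC0, hC⟩ := hs
    obtain ⟨D, hD0, hD⟩ := ht
    exact ⟨C * D, mul_nonneg hC0 hD0, fun A _ π hπ =>
      (norm_mul_le _ _).trans (mul_le_mul (hC A π hπ) (hD A π hπ) (norm_nonneg _) hC0)⟩
  | adj s hs =>
    obtain ⟨C, hC0, hC⟩ := hs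
    exact ⟨C, hC0, fun A _ π hπ => (norm_star (s.eval π)).trans_le (hC A π hπ)⟩

/-- The universal C*-norm: the supremum of `‖π(x)‖` over all families satisfying the relations. -/
instance : Norm R.Pre := ⟨fun x => sSup (normSet R x)⟩

theorem norm_ev_le {A : Type} [CStarAlgebra A] (π : G → A) (hπ : R.Holds π) (x : R.Pre) :
    ‖ev R π hπ x‖ ≤ ‖x‖ :=
  le_csSup (bddAbove_normSet R x) ⟨A, _, π, hπ, rfl⟩

variable {R} in
theorem norm_le_of {x : R.Pre} {C : ℝ} (hC : 0 ≤ C)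
    (h : ∀ (A : Type) [CStarAlgebra A] (π : G → A) (hπ : R.Holds π), ‖ev R π hπ x‖ ≤ C) :
    ‖x‖ ≤ C := by
  refine Real.sSup_le ?_ hC
  rintro r ⟨A, _, π, hπ, rfl⟩
  exact h A π hπ

theorem norm_nonneg' (x : R.Pre) : 0 ≤ ‖x‖ := by
  refine Real.sSup_nonneg ?_
  rintro r ⟨A, _, π, hπ, rfl⟩
  exact norm_nonneg _

/-- The universal C*-norm is a norm. -/
def addGroupNorm : AddGroupNorm R.Pre where
  toFun x := ‖x‖
  map_zero' := le_antisymm (norm_le_of le_rfl fun A _ π hπ => by simp) (norm_nonneg' R 0)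
  add_le' x y := norm_le_of (add_nonneg (norm_nonneg' R x) (norm_nonneg' R y))
    fun A _ π hπ => by
      rw [ev_add]
      exact (norm_add_le _ _).trans (add_le_add (norm_ev_le R π hπ x) (norm_ev_le R π hπ y))
  neg' x := le_antisymm
    (norm_le_of (norm_nonneg' R x) fun A _ π hπ => by
      rw [ev_neg, norm_neg]; exact norm_ev_le R π hπ x)
    (norm_le_of (norm_nonneg' R (-x)) fun A _ π hπ => by
      rw [← norm_neg, ← ev_neg]; exact norm_ev_le R π hπ (-x))
  eq_zero_of_map_eq_zero' x hx := ext' fun A _ π hπ => by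
    have h := norm_ev_le R π hπ x
    rw [ev_zero, ← norm_le_zero_iff]
    exact h.trans (le_of_eq hx)

instance : NormedRing R.Pre where
  __ := (inferInstance : Ring R.Pre)
  __ := (addGroupNorm R).toNormedAddCommGroup
  norm_mul_le x y := norm_le_of (mul_nonneg (norm_nonneg' R x) (norm_nonneg' R y))
    fun A _ π hπ => by
      rw [ev_mul]
      exact (norm_mul_le _ _).trans
        (mul_le_mul (norm_ev_le R π hπ x) (norm_ev_le R π hπ y) (norm_nonneg _) (norm_nonneg' R x))

instance : NormedAlgebra ℂ R.Pre where
  norm_smul_le c x := norm_le_of (mul_nonneg (norm_nonneg c) (norm_nonneg' R x))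
    fun A _ π hπ => by
      rw [ev_smul, norm_smul]
      exact mul_le_mul_of_nonneg_left (norm_ev_le R π hπ x) (norm_nonneg c)

instance : CStarRing R.Pre where
  norm_mul_self_le x := by
    have h : ‖x‖ ≤ Real.sqrt ‖star x * x‖ := norm_le_of (Real.sqrt_nonneg _) fun A _ π hπ => by
      refine Real.le_sqrt_of_sq_le ?_
      rw [sq, ← CStarRing.norm_star_mul_self, ← ev_star, ← ev_mul]
      exact norm_ev_le R π hπ _
    calc ‖x‖ * ‖x‖ ≤ Real.sqrt ‖star x * x‖ * Real.sqrt ‖star x * x‖ :=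
          mul_le_mul h h (norm_nonneg x) (Real.sqrt_nonneg _)
      _ = ‖star x * x‖ := Real.mul_self_sqrt (norm_nonneg _)

end Pre

/-- The universal unital C*-algebra generated by `G` subject to the relations `R`: the completion
of the `*`-algebra of `*`-polynomials in the universal C*-norm. -/
def Univ : Type := UniformSpace.Completion R.Pre

namespace Univ

open UniformSpace

instance : NormedRing R.Univ := inferInstanceAs (NormedRing (Completion R.Pre))
instance : CompleteSpace R.Univ := inferInstanceAs (CompleteSpace (Completion R.Pre))
instance : Algebra ℂ R.Univ := inferInstanceAs (Algebra ℂ (Completion R.Pre))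

instance : NormedAlgebra ℂ R.Univ where
  norm_smul_le := norm_smul_le (α := ℂ) (β := Completion R.Pre)

/-- The canonical map to the completion. -/
def coe (x : R.Pre) : R.Univ := (x : Completion R.Pre)

theorem denseRange_coe : DenseRange (coe R) := Completion.denseRange_coe
theorem continuous_coe : Continuous (coe R) := Completion.continuous_coe R.Pre
theorem coe_add (x y : R.Pre) : coe R (x + y) = coe R x + coe R y := Completion.coe_add x y
theorem coe_mul (x y : R.Pre) : coe R (x * y) = coe R x * coe R y := Completion.coe_mul x y
theorem coe_zero : coe R 0 = 0 := Completion.coe_zero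
theorem coe_one : coe R 1 = 1 := Completion.coe_one R.Pre
theorem coe_smul (c : ℂ) (x : R.Pre) : coe R (c • x) = c • coe R x := Completion.coe_smul c x
theorem norm_coe (x : R.Pre) : ‖coe R x‖ = ‖x‖ := Completion.norm_coe x

instance : Star R.Univ := ⟨Completion.map (star : R.Pre → R.Pre)⟩

theorem uniformContinuous_star' : UniformContinuous (star : R.Pre → R.Pre) :=
  (isometry_iff_dist_eq.2 fun x y => by
    rw [dist_eq_norm, dist_eq_norm, ← star_sub, norm_star]).uniformContinuous

theorem coe_star (x : R.Pre) : coe R (star x) = star (coe R x) :=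
  (Completion.map_coe (uniformContinuous_star' R) x).symm

theorem continuous_star' : Continuous (star : R.Univ → R.Univ) := Completion.continuous_map

instance : StarRing R.Univ where
  star_involutive x := by
    refine (denseRange_coe R).induction_on x
      (isClosed_eq ((continuous_star' R).comp (continuous_star' R)) continuous_id) fun a => ?_
    rw [← coe_star, ← coe_star, star_star]
  star_mul x y := by
    refine (denseRange_coe R).induction_on₂ (p := fun x y => star (x * y) = star y * star x)
      (isClosed_eq ((continuous_star' R).comp continuous_mul)
        (((continuous_star' R).comp continuous_snd).mul
          ((continuous_star' R).comp continuous_fst))) (fun a b => ?_) x y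
    rw [← coe_mul, ← coe_star, ← coe_star, ← coe_star, ← coe_mul, star_mul]
  star_add x y := by
    refine (denseRange_coe R).induction_on₂ (p := fun x y => star (x + y) = star x + star y)
      (isClosed_eq ((continuous_star' R).comp continuous_add)
        (((continuous_star' R).comp continuous_fst).add
          ((continuous_star' R).comp continuous_snd))) (fun a b => ?_) x y
    rw [← coe_add, ← coe_star, ← coe_star, ← coe_star, ← coe_add, star_add]

instance : CStarAlgebra R.Univ where
  norm_mul_self_le x := by
    refine (denseRange_coe R).induction_on x
      (isClosed_le (continuous_norm.mul continuous_norm)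
        (continuous_norm.comp ((continuous_star' R).mul continuous_id))) fun a => ?_
    change _ ≤ ‖star (coe R a) * coe R a‖
    rw [← coe_star, ← coe_mul, norm_coe, norm_coe]
    exact CStarRing.norm_mul_self_le a
  star_smul c x := by
    refine (denseRange_coe R).induction_on x
      (isClosed_eq ((continuous_star' R).comp (continuous_const_smul c))
        ((continuous_star' R).const_smul (star c))) fun a => ?_
    rw [← coe_smul, ← coe_star, ← coe_star, ← coe_smul, star_smul]

/-- The generators of the universal C*-algebra. -/
def of (g : G) : R.Univ := coe R (Quotient.mk _ (.gen g))

section lift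

variable {A : Type} [CStarAlgebra A] (π : G → A) (hπ : R.Holds π)

theorem continuous_evHom : Continuous (Pre.evHom R π hπ) :=
  AddMonoidHomClass.continuous_of_bound (Pre.evHom R π hπ) 1 fun x => by
    rw [one_mul]
    exact Pre.norm_ev_le R π hπ x

/-- The universal property: a family satisfying the relations extends to a `*`-homomorphism. -/
def lift : R.Univ →⋆ₐ[ℂ] A where
  toRingHom := Completion.extensionHom (Pre.evHom R π hπ : R.Pre →+* A)
    (continuous_evHom R π hπ)
  commutes' c := by
    change Completion.extensionHom (Pre.evHom R π hπ : R.Pre →+* A)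
      (continuous_evHom R π hπ) ((algebraMap ℂ R.Pre c : R.Pre) : Completion R.Pre) = _
    exact (Completion.extensionHom_coe (Pre.evHom R π hπ : R.Pre →+* A)
      (continuous_evHom R π hπ) _).trans ((Pre.evHom R π hπ).commutes c)
  map_star' x := by
    have hc : Continuous (Completion.extensionHom (Pre.evHom R π hπ : R.Pre →+* A)
      (continuous_evHom R π hπ)) := Completion.continuous_extension
    refine (denseRange_coe R).induction_on x
      (isClosed_eq (hc.comp (continuous_star' R)) (continuous_star.comp hc)) fun a => ?_
    rw [← coe_star]
    refine (Completion.extensionHom_coe (Pre.evHom R π hπ : R.Pre →+* A)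
      (continuous_evHom R π hπ) (star a)).trans ?_
    refine (map_star (Pre.evHom R π hπ) a).trans (congrArg star ?_)
    exact (Completion.extensionHom_coe (Pre.evHom R π hπ : R.Pre →+* A)
      (continuous_evHom R π hπ) a).symm

theorem lift_coe (x : R.Pre) : lift R π hπ (coe R x) = Pre.evHom R π hπ x :=
  Completion.extensionHom_coe (Pre.evHom R π hπ : R.Pre →+* A) (continuous_evHom R π hπ) x

@[simp] theorem lift_of (g : G) : lift R π hπ (of R g) = π g := lift_coe R π hπ _

end lift

theorem mem_of_closed (S : StarSubalgebra ℂ R.Univ) (hS : IsClosed (S : Set R.Univ))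
    (h : ∀ g, of R g ∈ S) (x : R.Univ) : x ∈ S := by
  refine (denseRange_coe R).induction_on x hS fun a => ?_
  induction a using Quotient.inductionOn with | _ s
  induction s with
  | gen g => exact h g
  | scalar c =>
    have : coe R (Quotient.mk _ (.scalar c)) = algebraMap ℂ R.Univ c := by
      rw [Algebra.algebraMap_eq_smul_one, ← coe_one, ← coe_smul]
      refine congrArg (coe R) (Pre.ext' fun A _ π hπ => ?_)
      rw [Pre.ev_smul, Pre.ev_one, ← Algebra.algebraMap_eq_smul_one]
      rfl
    rw [this]
    exact S.algebraMap_mem c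
  | plus s t hs ht => exact (coe_add R (Quotient.mk _ s) (Quotient.mk _ t)) ▸ S.add_mem hs ht
  | times s t hs ht => exact (coe_mul R (Quotient.mk _ s) (Quotient.mk _ t)) ▸ S.mul_mem hs ht
  | adj s hs => exact (coe_star R (Quotient.mk _ s)) ▸ star_mem hs

/-- `*`-homomorphisms of C*-algebras are continuous. -/
theorem continuous_hom {A B : Type} [CStarAlgebra A] [CStarAlgebra B] (φ : A →⋆ₐ[ℂ] B) :
    Continuous φ := map_continuous φ

theorem hom_ext {A : Type} [CStarAlgebra A] {φ ψ : R.Univ →⋆ₐ[ℂ] A}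
    (h : ∀ g, φ (of R g) = ψ (of R g)) : φ = ψ :=
  StarAlgHom.ext fun x => mem_of_closed R (StarAlgHom.equalizer φ ψ)
    (isClosed_eq (continuous_hom φ) (continuous_hom ψ)) h x

/-- The canonical map to the completion, as a `*`-homomorphism. -/
def coeHom : R.Pre →⋆ₐ[ℂ] R.Univ where
  toFun := coe R
  map_one' := coe_one R
  map_mul' := coe_mul R
  map_zero' := coe_zero R
  map_add' := coe_add R
  commutes' c := by
    rw [Algebra.algebraMap_eq_smul_one, Algebra.algebraMap_eq_smul_one, coe_smul, coe_one]
  map_star' := coe_star R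

/-- The generators of the dense `*`-algebra. -/
def pre (g : G) : R.Pre := Quotient.mk _ (.gen g)

theorem of_eq (g : G) : of R g = coeHom R (pre R g) := rfl

theorem evHom_pre {A : Type} [CStarAlgebra A] (π : G → A) (hπ : R.Holds π) (g : G) :
    Pre.evHom R π hπ (pre R g) = π g := rfl

/-- Elements given by `*`-polynomials agree if they agree on all families. -/
theorem coe_congr {x y : R.Pre}
    (h : ∀ (A : Type) [CStarAlgebra A] (π : G → A) (hπ : R.Holds π),
      Pre.evHom R π hπ x = Pre.evHom R π hπ y) : coeHom R x = coeHom R y :=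
  congrArg (coe R) (Pre.ext' h)

/-- A map from a C*-algebra `A` to the generators which is a `*`-homomorphism on all families
satisfying the relations gives a `*`-homomorphism to the universal C*-algebra. -/
def homOfGen {A : Type} [CStarAlgebra A] (f : A → G)
    (hf : ∀ (C : Type) [CStarAlgebra C] (π : G → C), R.Holds π →
      ∃ φ : A →⋆ₐ[ℂ] C, ∀ x, π (f x) = φ x) : A →⋆ₐ[ℂ] R.Univ where
  toFun x := of R (f x)
  map_one' := by
    rw [of_eq, ← map_one (coeHom R)]
    refine coe_congr R fun C _ π hπ => ?_
    obtain ⟨φ, hφ⟩ := hf C π hπ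
    rw [evHom_pre, hφ, map_one, map_one]
  map_mul' x y := by
    simp only [of_eq]
    rw [← map_mul]
    refine coe_congr R fun C _ π hπ => ?_
    obtain ⟨φ, hφ⟩ := hf C π hπ
    simp only [map_mul, evHom_pre, hφ]
  map_zero' := by
    rw [of_eq, ← map_zero (coeHom R)]
    refine coe_congr R fun C _ π hπ => ?_
    obtain ⟨φ, hφ⟩ := hf C π hπ
    rw [evHom_pre, hφ, map_zero, map_zero]
  map_add' x y := by
    simp only [of_eq]
    rw [← map_add]
    refine coe_congr R fun C _ π hπ => ?_
    obtain ⟨φ, hφ⟩ := hf C π hπ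
    simp only [map_add, evHom_pre, hφ]
  commutes' c := by
    rw [of_eq, ← AlgHomClass.commutes (coeHom R) c]
    refine coe_congr R fun C _ π hπ => ?_
    obtain ⟨φ, hφ⟩ := hf C π hπ
    rw [evHom_pre, hφ, AlgHomClass.commutes, AlgHomClass.commutes]
  map_star' x := by
    simp only [of_eq]
    rw [← map_star]
    refine coe_congr R fun C _ π hπ => ?_
    obtain ⟨φ, hφ⟩ := hf C π hπ
    simp only [map_star, evHom_pre, hφ]

end Univ
end Relations

/-! ### The C*-tensor product -/

section Tensor

variable (A B : Type) [CStarAlgebra A] [CStarAlgebra B]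

/-- The relations of the tensor product: the generators are a copy of `A` and a copy of `B`, which
are images of unital `*`-homomorphisms with commuting ranges. -/
def tensorRel : Relations (A ⊕ B) where
  Holds {C} _ π := ∃ (φ : A →⋆ₐ[ℂ] C) (ψ : B →⋆ₐ[ℂ] C), (∀ x, π (.inl x) = φ x) ∧
    (∀ y, π (.inr y) = ψ y) ∧ ∀ x y, Commute (φ x) (ψ y)
  bound := Sum.elim norm norm
  norm_le π h g := by
    obtain ⟨φ, ψ, hφ, hψ, -⟩ := h
    rcases g with x | y
    · rw [hφ]; exact NonUnitalStarAlgHom.norm_apply_le φ x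
    · rw [hψ]; exact NonUnitalStarAlgHom.norm_apply_le ψ y

/-- The (maximal) tensor product of unital C*-algebras. -/
abbrev Tensor : Type := (tensorRel A B).Univ

namespace Tensor

/-- `x ↦ x ⊗ 1`. -/
def inl : A →⋆ₐ[ℂ] Tensor A B :=
  Relations.Univ.homOfGen (tensorRel A B) Sum.inl fun _ _ _ ⟨φ, _, h, _, _⟩ => ⟨φ, h⟩

/-- `y ↦ 1 ⊗ y`. -/
def inr : B →⋆ₐ[ℂ] Tensor A B :=
  Relations.Univ.homOfGen (tensorRel A B) Sum.inr fun _ _ _ ⟨_, ψ, _, h, _⟩ => ⟨ψ, h⟩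

theorem inl_apply (x : A) : inl A B x = Relations.Univ.of (tensorRel A B) (.inl x) := rfl
theorem inr_apply (y : B) : inr A B y = Relations.Univ.of (tensorRel A B) (.inr y) := rfl

theorem commute (x : A) (y : B) : Commute (inl A B x) (inr A B y) := by
  rw [commute_iff_eq, inl_apply, inr_apply, Relations.Univ.of_eq, Relations.Univ.of_eq,
    ← map_mul, ← map_mul]
  refine Relations.Univ.coe_congr _ fun C _ π hπ => ?_
  rw [map_mul, map_mul, Relations.Univ.evHom_pre, Relations.Univ.evHom_pre]
  obtain ⟨φ, ψ, h1, h2, h⟩ := hπ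
  rw [h1, h2]
  exact h x y

variable {A B}

/-- The elementary tensor `x ⊗ y`. -/
def tmul (x : A) (y : B) : Tensor A B := inl A B x * inr A B y

/-- The universal property of the maximal tensor product. -/
def lift {C : Type} [CStarAlgebra C] (φ : A →⋆ₐ[ℂ] C) (ψ : B →⋆ₐ[ℂ] C)
    (h : ∀ x y, Commute (φ x) (ψ y)) : Tensor A B →⋆ₐ[ℂ] C :=
  Relations.Univ.lift (tensorRel A B) (Sum.elim φ ψ) ⟨φ, ψ, fun _ => rfl, fun _ => rfl, h⟩

section

variable {C : Type} [CStarAlgebra C] (φ : A →⋆ₐ[ℂ] C) (ψ : B →⋆ₐ[ℂ] C)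
    (h : ∀ x y, Commute (φ x) (ψ y))

@[simp] theorem lift_inl (x : A) : lift φ ψ h (inl A B x) = φ x := Relations.Univ.lift_of _ _ _ _
@[simp] theorem lift_inr (y : B) : lift φ ψ h (inr A B y) = ψ y := Relations.Univ.lift_of _ _ _ _
@[simp] theorem lift_tmul (x : A) (y : B) : lift φ ψ h (tmul x y) = φ x * ψ y := by
  rw [tmul, map_mul, lift_inl, lift_inr]

end

/-- The tensor product of two `*`-homomorphisms. -/
def map {C D : Type} [CStarAlgebra C] [CStarAlgebra D] (φ : A →⋆ₐ[ℂ] C) (ψ : B →⋆ₐ[ℂ] D) :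
    Tensor A B →⋆ₐ[ℂ] Tensor C D :=
  lift ((inl C D).comp φ) ((inr C D).comp ψ) fun x y => commute C D (φ x) (ψ y)

@[simp] theorem map_tmul {C D : Type} [CStarAlgebra C] [CStarAlgebra D] (φ : A →⋆ₐ[ℂ] C)
    (ψ : B →⋆ₐ[ℂ] D) (x : A) (y : B) : map φ ψ (tmul x y) = tmul (φ x) (ψ y) :=
  lift_tmul _ _ _ x y

end Tensor

end Tensor

/-! ### Magic unitaries and quantum permutation groups -/

/-- A magic unitary: a square matrix whose entries are projections and all of whose rows and columns
are partitions of unity, i.e. consist of pairwise orthogonal projections with sum `1`. -/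
structure IsMagicUnitary {ι A : Type} [Fintype ι] [CStarAlgebra A] (u : Matrix ι ι A) : Prop where
  proj : ∀ i j, IsStarProjection (u i j)
  row_orthogonal : ∀ i j k, j ≠ k → u i j * u i k = 0
  col_orthogonal : ∀ i j k, i ≠ k → u i j * u k j = 0
  row_sum : ∀ i, ∑ j, u i j = 1
  col_sum : ∀ j, ∑ i, u i j = 1

namespace IsMagicUnitary

variable {ι A B : Type} [Fintype ι] [CStarAlgebra A] [CStarAlgebra B] {u v : Matrix ι ι A}

theorem map (hu : IsMagicUnitary u) (φ : A →⋆ₐ[ℂ] B) : IsMagicUnitary (u.map φ) where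
  proj i j := (hu.proj i j).map φ
  row_orthogonal i j k h := by
    simp only [Matrix.map_apply, ← map_mul, hu.row_orthogonal i j k h, map_zero]
  col_orthogonal i j k h := by
    simp only [Matrix.map_apply, ← map_mul, hu.col_orthogonal i j k h, map_zero]
  row_sum i := by simp only [Matrix.map_apply, ← map_sum, hu.row_sum, map_one]
  col_sum i := by simp only [Matrix.map_apply, ← map_sum, hu.col_sum, map_one]

theorem entry_mul [DecidableEq ι] (hu : IsMagicUnitary u) (i j k : ι) :
    u i j * u i k = if j = k then u i j else 0 := by
  split_ifs with h
  · subst h; exact (hu.proj i j).isIdempotentElem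
  · exact hu.row_orthogonal i j k h

theorem entry_mul' [DecidableEq ι] (hu : IsMagicUnitary u) (i j k : ι) :
    u i j * u k j = if i = k then u i j else 0 := by
  split_ifs with h
  · subst h; exact (hu.proj i j).isIdempotentElem
  · exact hu.col_orthogonal i j k h

theorem mul (hu : IsMagicUnitary u) (hv : IsMagicUnitary v)
    (h : ∀ i j k l, Commute (u i j) (v k l)) : IsMagicUnitary (u * v) := by
  classical
  have key : ∀ i j k, (u * v) i j * (u * v) i k = ∑ l, u i l * (v l j * v l k) := fun i j k => by
    simp only [Matrix.mul_apply, Finset.sum_mul_sum]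
    refine Finset.sum_congr rfl fun l _ => ?_
    have : ∀ m, u i l * v l j * (u i m * v m k) = u i l * u i m * (v l j * v m k) := fun m => by
      rw [mul_assoc, ← mul_assoc (v l j), ← (h i m l j).eq]; simp only [mul_assoc]
    simp only [this, hu.entry_mul, ite_mul, zero_mul, Finset.sum_ite_eq, Finset.mem_univ, if_true]
  have key' : ∀ i j k, (u * v) i j * (u * v) k j = ∑ l, (u i l * u k l) * v l j := fun i j k => by
    simp only [Matrix.mul_apply, Finset.sum_mul_sum]
    refine Finset.sum_congr rfl fun l _ => ?_
    have : ∀ m, u i l * v l j * (u k m * v m j) = u i l * u k m * (v l j * v m j) := fun m => by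
      rw [mul_assoc, ← mul_assoc (v l j), ← (h k m l j).eq]; simp only [mul_assoc]
    simp only [this, hv.entry_mul', mul_ite, mul_zero, Finset.sum_ite_eq, Finset.mem_univ, if_true]
  refine ⟨fun i j => ⟨?_, ?_⟩, fun i j k hjk => ?_, fun i j k hik => ?_, fun i => ?_, fun j => ?_⟩
  · rw [IsIdempotentElem, key, Matrix.mul_apply]
    simp only [hv.entry_mul, if_true]
  · rw [IsSelfAdjoint, Matrix.mul_apply, star_sum]
    refine Finset.sum_congr rfl fun l _ => ?_
    rw [star_mul, (hu.proj i l).isSelfAdjoint.star_eq, (hv.proj l j).isSelfAdjoint.star_eq,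
      (h i l l j).eq]
  · rw [key]
    simp only [hv.row_orthogonal _ _ _ hjk, mul_zero, Finset.sum_const_zero]
  · rw [key']
    simp only [hu.col_orthogonal _ _ _ hik, zero_mul, Finset.sum_const_zero]
  · simp only [Matrix.mul_apply]
    rw [Finset.sum_comm]
    simp only [← Finset.mul_sum, hv.row_sum, mul_one, hu.row_sum]
  · simp only [Matrix.mul_apply]
    rw [Finset.sum_comm]
    simp only [← Finset.sum_mul, hu.col_sum, one_mul, hv.col_sum]

end IsMagicUnitary

/-- A quantum permutation group on the finite set `ι`, described dually: a Hopf C*-algebra `A`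
together with a multiplicative magic unitary matrix `u`, indexed by `ι`, whose entries generate `A`.

As the entries of `u` generate `A`, the values of the comultiplication, the counit and the antipode
on them determine these morphisms, and the Hopf algebra axioms follow from these values: see
`coassoc`, `counit_comul` and `antipode_antipode` below; the antipode axiom
`∑ k, S (u i k) * u k j = ∑ k, u k i * u k j = δ i j` is part of magic unitarity. -/
structure QuantumPermGroup (ι : Type) [Fintype ι] [DecidableEq ι] : Type 1 where
  /-- the C*-algebra -/
  A : Type
  [cstar : CStarAlgebra A]
  /-- the fundamental magic unitary -/
  u : Matrix ι ι A
  magic : IsMagicUnitary u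
  generates : (StarAlgebra.adjoin ℂ (Set.range fun p : ι × ι => u p.1 p.2)).topologicalClosure = ⊤
  /-- the comultiplication -/
  comul : A →⋆ₐ[ℂ] Tensor A A
  comul_u : ∀ i j, comul (u i j) = ∑ k, Tensor.tmul (u i k) (u k j)
  /-- the counit -/
  counit : A →⋆ₐ[ℂ] ℂ
  counit_u : ∀ i j, counit (u i j) = if i = j then 1 else 0
  /-- the antipode -/
  antipode : A →⋆ₐ[ℂ] Aᵐᵒᵖ
  antipode_u : ∀ i j, antipode (u i j) = MulOpposite.op (u j i)

attribute [instance] QuantumPermGroup.cstar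

namespace QuantumPermGroup

variable {ι : Type} [Fintype ι] [DecidableEq ι]

theorem mem_of_closed (P : QuantumPermGroup ι) (S : StarSubalgebra ℂ P.A)
    (hS : IsClosed (S : Set P.A)) (h : ∀ i j, P.u i j ∈ S) (x : P.A) : x ∈ S := by
  have h1 : StarAlgebra.adjoin ℂ (Set.range fun p : ι × ι => P.u p.1 p.2) ≤ S :=
    StarAlgebra.adjoin_le (by rintro _ ⟨p, rfl⟩; exact h p.1 p.2)
  have h2 := StarSubalgebra.topologicalClosure_minimal h1 hS
  rw [P.generates] at h2
  exact h2 trivial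

theorem hom_ext (P : QuantumPermGroup ι) {B : Type} [CStarAlgebra B] {φ ψ : P.A →⋆ₐ[ℂ] B}
    (h : ∀ i j, φ (P.u i j) = ψ (P.u i j)) : φ = ψ :=
  StarAlgHom.ext fun x => P.mem_of_closed (StarAlgHom.equalizer φ ψ)
    (isClosed_eq (map_continuous φ) (map_continuous ψ)) h x

/-- A self-adjoint element commuting with the images of the entries of `u` commutes with the images
of all elements. -/
theorem commute_of (P : QuantumPermGroup ι) {C : Type} [CStarAlgebra C] (φ : P.A →⋆ₐ[ℂ] C) (c : C)
    (hc : star c = c) (h : ∀ i j, Commute (φ (P.u i j)) c) (x : P.A) : Commute (φ x) c := by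
  have hx : x ∈ (StarSubalgebra.centralizer ℂ {c}).comap φ := by
    refine P.mem_of_closed _ ((Set.isClosed_centralizer _).preimage (map_continuous φ))
      (fun i j => ?_) x
    refine (StarSubalgebra.mem_centralizer_iff ℂ).2 ?_
    rintro _ rfl
    rw [hc]
    exact ⟨(h i j).eq.symm, (h i j).eq.symm⟩
  exact ((StarSubalgebra.mem_centralizer_iff ℂ).1 hx c rfl).1.symm

section

variable (A B C : Type) [CStarAlgebra A] [CStarAlgebra B] [CStarAlgebra C]

/-- The canonical map `A ⊗ B → A ⊗ (B ⊗ C)`, `x ⊗ y ↦ x ⊗ (y ⊗ 1)`. -/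
def tensorAssocAux : Tensor A B →⋆ₐ[ℂ] Tensor A (Tensor B C) :=
  Tensor.lift (Tensor.inl A (Tensor B C)) ((Tensor.inr A (Tensor B C)).comp (Tensor.inl B C))
    fun x y => Tensor.commute A (Tensor B C) x (Tensor.inl B C y)

theorem tensorAssocAux_commute (x : Tensor A B) (c : C) :
    Commute (tensorAssocAux A B C x) (Tensor.inr A (Tensor B C) (Tensor.inr B C c)) := by
  let ψ := (Tensor.inr A (Tensor B C)).comp (Tensor.inr B C)
  have hS : ∀ y, (∀ c, Commute y (ψ c)) → y ∈ StarSubalgebra.centralizer ℂ (Set.range ψ) :=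
    fun y hy => by
      refine (StarSubalgebra.mem_centralizer_iff ℂ).2 ?_
      rintro _ ⟨c, rfl⟩
      refine ⟨(hy c).eq.symm, ?_⟩
      rw [← map_star]
      exact (hy (star c)).eq.symm
  have h : x ∈ (StarSubalgebra.centralizer ℂ (Set.range ψ)).comap (tensorAssocAux A B C) := by
    refine Relations.Univ.mem_of_closed _ _ ((Set.isClosed_centralizer _).preimage
      (map_continuous (tensorAssocAux A B C))) (fun g => ?_) x
    rcases g with a | b
    · refine hS _ fun c => ?_
      have e : tensorAssocAux A B C (Tensor.inl A B a) = Tensor.inl A (Tensor B C) a :=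
        Tensor.lift_inl _ _ _ a
      change Commute (tensorAssocAux A B C (Tensor.inl A B a)) _
      rw [e]
      exact Tensor.commute A (Tensor B C) a (Tensor.inr B C c)
    · refine hS _ fun c => ?_
      have e : tensorAssocAux A B C (Tensor.inr A B b) =
        Tensor.inr A (Tensor B C) (Tensor.inl B C b) := Tensor.lift_inr _ _ _ b
      change Commute (tensorAssocAux A B C (Tensor.inr A B b)) _
      rw [e]
      exact (Tensor.commute B C b c).map (Tensor.inr A (Tensor B C))
  exact (((StarSubalgebra.mem_centralizer_iff ℂ).1 h) _ ⟨c, rfl⟩).1.symm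

/-- The canonical map `(A ⊗ B) ⊗ C → A ⊗ (B ⊗ C)`. -/
def tensorAssoc : Tensor (Tensor A B) C →⋆ₐ[ℂ] Tensor A (Tensor B C) :=
  Tensor.lift (tensorAssocAux A B C) ((Tensor.inr A (Tensor B C)).comp (Tensor.inr B C))
    (tensorAssocAux_commute A B C)

theorem tensorAssoc_tmul (x : A) (y : B) (z : C) :
    tensorAssoc A B C (Tensor.tmul (Tensor.tmul x y) z) = Tensor.tmul x (Tensor.tmul y z) := by
  have e : tensorAssocAux A B C (Tensor.tmul x y) =
      Tensor.inl A (Tensor B C) x * Tensor.inr A (Tensor B C) (Tensor.inl B C y) :=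
    Tensor.lift_tmul _ _ _ x y
  have e' : tensorAssoc A B C (Tensor.tmul (Tensor.tmul x y) z) =
      tensorAssocAux A B C (Tensor.tmul x y) * Tensor.inr A (Tensor B C) (Tensor.inr B C z) :=
    Tensor.lift_tmul _ _ _ _ z
  rw [e', e]
  simp only [Tensor.tmul, map_mul, mul_assoc]

end

/-- Coassociativity of the comultiplication. -/
theorem coassoc (P : QuantumPermGroup ι) :
    (tensorAssoc P.A P.A P.A).comp ((Tensor.map P.comul (.id ℂ P.A)).comp P.comul) =
      (Tensor.map (.id ℂ P.A) P.comul).comp P.comul := by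
  refine P.hom_ext fun i j => ?_
  have h2 : ∀ (s : ι → Tensor P.A P.A) (z : P.A),
      Tensor.tmul (∑ k, s k) z = ∑ k, Tensor.tmul (s k) z := fun s z => by
    simp only [Tensor.tmul, map_sum, Finset.sum_mul]
  have h3 : ∀ (x : P.A) (s : ι → Tensor P.A P.A),
      Tensor.tmul x (∑ k, s k) = ∑ k, Tensor.tmul x (s k) := fun x s => by
    simp only [Tensor.tmul, map_sum, Finset.mul_sum]
  simp only [StarAlgHom.comp_apply, P.comul_u, map_sum, Tensor.map_tmul, tensorAssoc_tmul, h2, h3,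
    StarAlgHom.coe_id, id_eq]
  rw [Finset.sum_comm]

/-- The counit axioms, `(ε ⊗ id)Δ = id = (id ⊗ ε)Δ`, in terms of the canonical maps from `ℂ`. -/
theorem counit_comul (P : QuantumPermGroup ι) (x : P.A) :
    Tensor.lift ((StarAlgHom.ofId ℂ P.A).comp P.counit) (.id ℂ P.A)
      (fun _ y => Algebra.commutes _ y) (P.comul x) = x ∧
    Tensor.lift (.id ℂ P.A) ((StarAlgHom.ofId ℂ P.A).comp P.counit)
      (fun y _ => (Algebra.commutes _ y).symm) (P.comul x) = x := by
  constructor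
  · refine DFunLike.congr_fun (P.hom_ext (φ := StarAlgHom.comp
      (Tensor.lift ((StarAlgHom.ofId ℂ P.A).comp P.counit) (.id ℂ P.A)
        (fun _ y => Algebra.commutes _ y)) P.comul)
      (ψ := .id ℂ P.A) fun i j => ?_) x
    rw [StarAlgHom.comp_apply, P.comul_u, map_sum]
    refine (Finset.sum_congr rfl fun k _ => Tensor.lift_tmul _ _ _ _ _).trans ?_
    simp [P.counit_u]
  · refine DFunLike.congr_fun (P.hom_ext (φ := StarAlgHom.comp
      (Tensor.lift (.id ℂ P.A) ((StarAlgHom.ofId ℂ P.A).comp P.counit)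
        (fun y _ => (Algebra.commutes _ y).symm)) P.comul)
      (ψ := .id ℂ P.A) fun i j => ?_) x
    rw [StarAlgHom.comp_apply, P.comul_u, map_sum]
    refine (Finset.sum_congr rfl fun k _ => Tensor.lift_tmul _ _ _ _ _).trans ?_
    simp [P.counit_u]

/-- The square of the antipode is the identity. -/
theorem antipode_antipode (P : QuantumPermGroup ι) (x : P.A) :
    (P.antipode (P.antipode x).unop).unop = x := by
  let S : StarSubalgebra ℂ P.A :=
    { carrier := {x | (P.antipode (P.antipode x).unop).unop = x}
      mul_mem' := fun {a b} ha hb => by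
        simp only [Set.mem_ofPred_eq] at ha hb ⊢
        simp [ha, hb]
      add_mem' := fun {a b} ha hb => by
        simp only [Set.mem_ofPred_eq] at ha hb ⊢
        simp [ha, hb]
      algebraMap_mem' := fun c => by
        simp [AlgHomClass.commutes, MulOpposite.algebraMap_apply]
      star_mem' := fun {a} ha => by
        simp only [Set.mem_ofPred_eq] at ha ⊢
        simp [map_star, ha] }
  have hS : IsClosed (S : Set P.A) := by
    have hc : Continuous P.antipode := map_continuous P.antipode
    exact isClosed_eq (MulOpposite.continuous_unop.comp
      (hc.comp (MulOpposite.continuous_unop.comp hc))) continuous_id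
  exact P.mem_of_closed S hS (fun i j => by
    change (P.antipode (P.antipode (P.u i j)).unop).unop = P.u i j
    simp [P.antipode_u]) x

end QuantumPermGroup

/-! ### Quantum automorphism groups of graphs -/

section Graph

variable {V : Type} [Fintype V] [DecidableEq V] (X : SimpleGraph V) [DecidableRel X.Adj]

/-- The relations of `A(X)`: the generators form a magic unitary matrix which commutes with the
adjacency matrix of `X`. -/
def graphRel : Relations (V × V) where
  Holds {A} _ π := IsMagicUnitary (Matrix.of fun i j => π (i, j)) ∧
    Commute (X.adjMatrix A) (Matrix.of fun i j => π (i, j))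
  bound _ := 1
  norm_le _ h g := (h.1.proj g.1 g.2).norm_le

theorem adjMatrix_map {A B : Type} [CStarAlgebra A] [CStarAlgebra B] (φ : A →⋆ₐ[ℂ] B) :
    (X.adjMatrix A).map φ = X.adjMatrix B := by
  ext i j
  simp [SimpleGraph.adjMatrix_apply, apply_ite φ]

/-- The matrix of generators of `A(X)`. -/
def graphU : Matrix V V (graphRel X).Univ := Matrix.of fun i j => Relations.Univ.of _ (i, j)

theorem graphU_apply (i j : V) : graphU X i j = Relations.Univ.of (graphRel X) (i, j) := rfl

theorem graphU_magic : IsMagicUnitary (graphU X) := by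
  refine ⟨fun i j => ⟨?_, ?_⟩, fun i j k h => ?_, fun i j k h => ?_, fun i => ?_, fun j => ?_⟩
  · rw [IsIdempotentElem, graphU_apply, Relations.Univ.of_eq, ← map_mul]
    refine Relations.Univ.coe_congr _ fun A _ π hπ => ?_
    rw [map_mul, Relations.Univ.evHom_pre]
    exact (hπ.1.proj i j).isIdempotentElem
  · rw [IsSelfAdjoint, graphU_apply, Relations.Univ.of_eq, ← map_star]
    refine Relations.Univ.coe_congr _ fun A _ π hπ => ?_
    rw [map_star, Relations.Univ.evHom_pre]
    exact (hπ.1.proj i j).isSelfAdjoint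
  · rw [graphU_apply, graphU_apply, Relations.Univ.of_eq, Relations.Univ.of_eq, ← map_mul,
      ← map_zero (Relations.Univ.coeHom _)]
    refine Relations.Univ.coe_congr _ fun A _ π hπ => ?_
    rw [map_mul, map_zero, Relations.Univ.evHom_pre, Relations.Univ.evHom_pre]
    exact hπ.1.row_orthogonal i j k h
  · rw [graphU_apply, graphU_apply, Relations.Univ.of_eq, Relations.Univ.of_eq, ← map_mul,
      ← map_zero (Relations.Univ.coeHom _)]
    refine Relations.Univ.coe_congr _ fun A _ π hπ => ?_
    rw [map_mul, map_zero, Relations.Univ.evHom_pre, Relations.Univ.evHom_pre]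
    exact hπ.1.col_orthogonal i j k h
  · simp only [graphU_apply, Relations.Univ.of_eq]
    rw [← map_sum, ← map_one (Relations.Univ.coeHom _)]
    refine Relations.Univ.coe_congr _ fun A _ π hπ => ?_
    simp only [map_sum, map_one, Relations.Univ.evHom_pre]
    exact hπ.1.row_sum i
  · simp only [graphU_apply, Relations.Univ.of_eq]
    rw [← map_sum, ← map_one (Relations.Univ.coeHom _)]
    refine Relations.Univ.coe_congr _ fun A _ π hπ => ?_
    simp only [map_sum, map_one, Relations.Univ.evHom_pre]
    exact hπ.1.col_sum j

theorem graphU_commute : Commute (X.adjMatrix (graphRel X).Univ) (graphU X) := by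
  rw [commute_iff_eq]
  ext i j
  simp only [SimpleGraph.adjMatrix_mul_apply, SimpleGraph.mul_adjMatrix_apply, graphU_apply,
    Relations.Univ.of_eq]
  rw [← map_sum, ← map_sum]
  refine Relations.Univ.coe_congr _ fun A _ π hπ => ?_
  have h := congrFun (congrFun hπ.2.eq i) j
  simp only [SimpleGraph.adjMatrix_mul_apply, SimpleGraph.mul_adjMatrix_apply,
    Matrix.of_apply] at h
  simpa only [map_sum, Relations.Univ.evHom_pre] using h

/-- The universal property of `A(X)`. -/
def graphLift {A : Type} [CStarAlgebra A] (v : Matrix V V A) (hv : IsMagicUnitary v)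
    (hX : Commute (X.adjMatrix A) v) : (graphRel X).Univ →⋆ₐ[ℂ] A :=
  Relations.Univ.lift (graphRel X) (fun p => v p.1 p.2) ⟨hv, hX⟩

theorem graphLift_u {A : Type} [CStarAlgebra A] (v : Matrix V V A) (hv : IsMagicUnitary v)
    (hX : Commute (X.adjMatrix A) v) (i j : V) : graphLift X v hv hX (graphU X i j) = v i j :=
  Relations.Univ.lift_of _ _ _ _

theorem commute_map {A B : Type} [CStarAlgebra A] [CStarAlgebra B] (φ : A →⋆ₐ[ℂ] B)
    {u : Matrix V V A} (h : Commute (X.adjMatrix A) u) :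
    Commute (X.adjMatrix B) (u.map φ) := by
  have h' := congrArg (fun M : Matrix V V A => M.map φ) h.eq
  simp only [Matrix.map_mul, adjMatrix_map] at h'
  exact h'

/-- The quantum automorphism group of a finite graph `X`: the algebra `A(X)` is the universal
C*-algebra generated by the entries of a magic unitary matrix `u` indexed by the vertices and
commuting with the adjacency matrix of `X`, with `Δ(u i j) = ∑ k, u i k ⊗ u k j`,
`ε(u i j) = δ i j` and `S(u i j) = u j i`. -/
def quantumAut : QuantumPermGroup V where
  A := (graphRel X).Univ
  u := graphU X
  magic := graphU_magic X
  generates := by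
    refine top_unique fun x _ => Relations.Univ.mem_of_closed _ _
      (StarSubalgebra.isClosed_topologicalClosure _) (fun g => ?_) x
    exact StarSubalgebra.le_topologicalClosure _ (StarAlgebra.subset_adjoin ℂ _ ⟨g, rfl⟩)
  comul := graphLift X
    ((graphU X).map (Tensor.inl _ _) * (graphU X).map (Tensor.inr _ _))
    (((graphU_magic X).map _).mul ((graphU_magic X).map _) fun _ _ _ _ => Tensor.commute _ _ _ _)
    ((commute_map X _ (graphU_commute X)).mul_right (commute_map X _ (graphU_commute X)))
  comul_u i j := graphLift_u _ _ _ _ i j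
  counit := graphLift X 1
    { proj := fun i j => by
        by_cases h : i = j
        · subst h; rw [Matrix.one_apply_eq]; exact .one ℂ
        · rw [Matrix.one_apply_ne h]; exact .zero ℂ
      row_orthogonal := fun i j k h => by
        by_cases h' : i = j
        · subst h'; rw [Matrix.one_apply_ne h, mul_zero]
        · rw [Matrix.one_apply_ne h', zero_mul]
      col_orthogonal := fun i j k h => by
        by_cases h' : i = j
        · subst h'; rw [Matrix.one_apply_ne h.symm, mul_zero]
        · rw [Matrix.one_apply_ne h', zero_mul]
      row_sum := fun i => by simp [Matrix.one_apply]
      col_sum := fun j => by simp [Matrix.one_apply] }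
    (Commute.one_right _)
  counit_u i j := graphLift_u _ _ _ _ i j
  antipode := graphLift X (Matrix.of fun i j => MulOpposite.op (graphU X j i))
    { proj := fun i j => ⟨congrArg MulOpposite.op ((graphU_magic X).proj j i).isIdempotentElem.eq,
        congrArg MulOpposite.op ((graphU_magic X).proj j i).isSelfAdjoint.star_eq⟩
      row_orthogonal := fun i j k h =>
        congrArg MulOpposite.op ((graphU_magic X).col_orthogonal k i j h.symm)
      col_orthogonal := fun i j k h =>
        congrArg MulOpposite.op ((graphU_magic X).row_orthogonal j k i h.symm)
      row_sum := fun i => by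
        simpa only [Finset.op_sum, MulOpposite.op_one, Matrix.of_apply] using
          congrArg MulOpposite.op ((graphU_magic X).col_sum i)
      col_sum := fun j => by
        simpa only [Finset.op_sum, MulOpposite.op_one, Matrix.of_apply] using
          congrArg MulOpposite.op ((graphU_magic X).row_sum j) }
    (by
      rw [commute_iff_eq]
      ext i j
      have h := congrFun (congrFun (graphU_commute X).eq j) i
      simp only [SimpleGraph.adjMatrix_mul_apply, SimpleGraph.mul_adjMatrix_apply,
        Matrix.of_apply] at h ⊢
      rw [← Finset.op_sum, ← Finset.op_sum, h])
  antipode_u i j := graphLift_u _ _ _ _ i j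

/-- The lexicographic product `X ∘ Y`: a copy of `X` at each vertex of `Y`. -/
def lexProd {V W : Type} (X : SimpleGraph V) (Y : SimpleGraph W) : SimpleGraph (V × W) where
  Adj p q := Y.Adj p.2 q.2 ∨ (p.2 = q.2 ∧ X.Adj p.1 q.1)
  symm := ⟨fun _ _ h => h.imp (fun h => h.symm) (fun h => ⟨h.1.symm, h.2.symm⟩)⟩
  loopless := ⟨fun _ h => h.elim (fun h => h.ne rfl) (fun h => h.2.ne rfl)⟩

instance {V W : Type} (X : SimpleGraph V) (Y : SimpleGraph W) [DecidableEq W]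
    [DecidableRel X.Adj] [DecidableRel Y.Adj] : DecidableRel (lexProd X Y).Adj := fun p q =>
  inferInstanceAs (Decidable (Y.Adj p.2 q.2 ∨ (p.2 = q.2 ∧ X.Adj p.1 q.1)))

end Graph

/-! ### Free wreath products -/

/-- If `p` is a partition of unity in `C` and `φ a` is a `*`-homomorphism to `C` commuting with
`p a`, then `x ↦ ∑ a, φ a x * p a` is a `*`-homomorphism. -/
def glue {κ A C : Type} [Fintype κ] [CStarAlgebra A] [CStarAlgebra C] (φ : κ → A →⋆ₐ[ℂ] C)
    (p : κ → C) (hp : ∀ a, IsStarProjection (p a)) (horth : ∀ a b, a ≠ b → p a * p b = 0)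
    (hsum : ∑ a, p a = 1) (hcomm : ∀ a x, Commute (φ a x) (p a)) : A →⋆ₐ[ℂ] C where
  toFun x := ∑ a, φ a x * p a
  map_one' := by simp only [map_one, one_mul, hsum]
  map_mul' x y := by
    classical
    rw [Finset.sum_mul_sum]
    refine Finset.sum_congr rfl fun a _ => ?_
    rw [Finset.sum_eq_single a]
    · rw [map_mul, mul_assoc (φ a x) (p a), ← mul_assoc (p a), ← (hcomm a y).eq,
        mul_assoc (φ a y), (hp a).isIdempotentElem.eq, mul_assoc]
    · intro b _ hb
      rw [(hcomm b y).eq, mul_assoc, ← mul_assoc (p a), horth a b hb.symm, zero_mul, mul_zero]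
    · intro h; exact absurd (Finset.mem_univ a) h
  map_zero' := by simp only [map_zero, zero_mul, Finset.sum_const_zero]
  map_add' x y := by simp only [map_add, add_mul, Finset.sum_add_distrib]
  commutes' c := by
    simp only [AlgHomClass.commutes, ← Finset.mul_sum, hsum, mul_one]
  map_star' x := by
    rw [star_sum]
    refine Finset.sum_congr rfl fun a _ => ?_
    rw [star_mul, (hp a).isSelfAdjoint.star_eq, map_star, ← map_star, (hcomm a (star x)).eq]

section FreeWreath

variable {ι κ : Type} [Fintype ι] [DecidableEq ι] [Fintype κ] [DecidableEq κ]
  (P : QuantumPermGroup ι) (Q : QuantumPermGroup κ)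

/-- The relations of the free wreath product of `(A, u)` and `(B, v)`: the generators are copies of
`A`, indexed by `κ`, and a copy of `B`, which are images of unital `*`-homomorphisms, and the
entries of `u` in the `a`-th copy of `A` commute with the `a`-th row of `v`. -/
def wreathRel : Relations (κ × P.A ⊕ Q.A) where
  Holds {C} _ π := ∃ (φ : κ → P.A →⋆ₐ[ℂ] C) (ψ : Q.A →⋆ₐ[ℂ] C),
    (∀ a x, π (.inl (a, x)) = φ a x) ∧ (∀ y, π (.inr y) = ψ y) ∧
      ∀ i j a b, Commute (φ a (P.u i j)) (ψ (Q.u a b))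
  bound := Sum.elim (fun p => ‖p.2‖) (fun y => ‖y‖)
  norm_le π h g := by
    obtain ⟨φ, ψ, hφ, hψ, -⟩ := h
    rcases g with ⟨a, x⟩ | y
    · rw [hφ]; exact NonUnitalStarAlgHom.norm_apply_le (φ a) x
    · rw [hψ]; exact NonUnitalStarAlgHom.norm_apply_le ψ y

/-- The C*-algebra `A *_w B`. -/
abbrev Wreath : Type := (wreathRel P Q).Univ

namespace Wreath

/-- The `a`-th copy of `A` in `A *_w B`. -/
def left (a : κ) : P.A →⋆ₐ[ℂ] Wreath P Q :=
  Relations.Univ.homOfGen (wreathRel P Q) (fun x => .inl (a, x))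
    fun _ _ _ ⟨φ, _, h, _, _⟩ => ⟨φ a, h a⟩

/-- The copy of `B` in `A *_w B`. -/
def right : Q.A →⋆ₐ[ℂ] Wreath P Q :=
  Relations.Univ.homOfGen (wreathRel P Q) Sum.inr fun _ _ _ ⟨_, ψ, _, h, _⟩ => ⟨ψ, h⟩

theorem left_apply (a : κ) (x : P.A) :
    left P Q a x = Relations.Univ.of (wreathRel P Q) (.inl (a, x)) := rfl
theorem right_apply (y : Q.A) : right P Q y = Relations.Univ.of (wreathRel P Q) (.inr y) := rfl

theorem commute_u (a b : κ) (i j : ι) : Commute (left P Q a (P.u i j)) (right P Q (Q.u a b)) := by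
  rw [commute_iff_eq, left_apply, right_apply, Relations.Univ.of_eq, Relations.Univ.of_eq,
    ← map_mul, ← map_mul]
  refine Relations.Univ.coe_congr _ fun C _ π hπ => ?_
  rw [map_mul, map_mul, Relations.Univ.evHom_pre, Relations.Univ.evHom_pre]
  obtain ⟨φ, ψ, h1, h2, h⟩ := hπ
  rw [h1, h2]
  exact h i j a b

theorem commute (a b : κ) (x : P.A) : Commute (left P Q a x) (right P Q (Q.u a b)) :=
  P.commute_of (left P Q a) _ (by rw [← map_star, (Q.magic.proj a b).isSelfAdjoint.star_eq])
    (commute_u P Q a b) x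

variable {P Q} in
/-- The universal property of `A *_w B`. -/
def lift {C : Type} [CStarAlgebra C] (φ : κ → P.A →⋆ₐ[ℂ] C) (ψ : Q.A →⋆ₐ[ℂ] C)
    (h : ∀ i j a b, Commute (φ a (P.u i j)) (ψ (Q.u a b))) : Wreath P Q →⋆ₐ[ℂ] C :=
  Relations.Univ.lift (wreathRel P Q) (Sum.elim (fun p => φ p.1 p.2) ψ)
    ⟨φ, ψ, fun _ _ => rfl, fun _ => rfl, h⟩

section

variable {P Q}
variable {C : Type} [CStarAlgebra C] (φ : κ → P.A →⋆ₐ[ℂ] C) (ψ : Q.A →⋆ₐ[ℂ] C)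
  (h : ∀ i j a b, Commute (φ a (P.u i j)) (ψ (Q.u a b)))

theorem lift_left (a : κ) (x : P.A) : lift φ ψ h (left P Q a x) = φ a x :=
  Relations.Univ.lift_of _ _ _ _
theorem lift_right (y : Q.A) : lift φ ψ h (right P Q y) = ψ y :=
  Relations.Univ.lift_of _ _ _ _

end

/-- The magic unitary `w (i, a) (j, b) = u^(a) i j * v a b`. -/
def w : Matrix (ι × κ) (ι × κ) (Wreath P Q) :=
  Matrix.of fun p q => left P Q p.2 (P.u p.1 q.1) * right P Q (Q.u p.2 q.2)

theorem w_apply (i j : ι) (a b : κ) :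
    w P Q (i, a) (j, b) = left P Q a (P.u i j) * right P Q (Q.u a b) := rfl

theorem w_magic : IsMagicUnitary (w P Q) := by
  have hc := commute P Q
  have hswap : ∀ i j k l a b c, left P Q a (P.u i j) * right P Q (Q.u a b) *
      (left P Q a (P.u k l) * right P Q (Q.u a c)) =
      left P Q a (P.u i j * P.u k l) * right P Q (Q.u a b * Q.u a c) := fun i j k l a b c => by
    rw [mul_assoc, ← mul_assoc (right P Q _), ← (hc a b (P.u k l)).eq, map_mul, map_mul]
    simp only [mul_assoc]
  refine ⟨?_, ?_, ?_, ?_, ?_⟩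
  · rintro ⟨i, a⟩ ⟨j, b⟩
    refine ⟨?_, ?_⟩
    · rw [IsIdempotentElem, w_apply, hswap, (P.magic.proj i j).isIdempotentElem.eq,
        (Q.magic.proj a b).isIdempotentElem.eq]
    · rw [IsSelfAdjoint, w_apply, star_mul, ← map_star, ← map_star,
        (P.magic.proj i j).isSelfAdjoint.star_eq, (Q.magic.proj a b).isSelfAdjoint.star_eq,
        (hc a b _).eq]
  · rintro ⟨i, a⟩ ⟨j, b⟩ ⟨k, c⟩ h
    rw [w_apply, w_apply, hswap]
    by_cases hbc : b = c
    · subst hbc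
      rw [P.magic.row_orthogonal i j k fun e => h (by rw [e]), map_zero, zero_mul]
    · rw [Q.magic.row_orthogonal a b c hbc, map_zero, mul_zero]
  · rintro ⟨i, a⟩ ⟨j, b⟩ ⟨k, c⟩ h
    rw [w_apply, w_apply]
    by_cases hac : a = c
    · subst hac
      rw [hswap, P.magic.col_orthogonal i j k fun e => h (by rw [e]), map_zero, zero_mul]
    · rw [(hc c b _).eq, mul_assoc, ← mul_assoc (right P Q _), ← map_mul,
        Q.magic.col_orthogonal a b c hac, map_zero, zero_mul, mul_zero]
  · rintro ⟨i, a⟩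
    simp only [Fintype.sum_prod_type, w_apply]
    simp only [← Finset.mul_sum, ← map_sum, Q.magic.row_sum, P.magic.row_sum, map_one, mul_one]
  · rintro ⟨j, b⟩
    rw [Fintype.sum_prod_type_right]
    simp only [w_apply]
    simp only [← Finset.sum_mul, ← map_sum, Q.magic.col_sum, P.magic.col_sum, map_one, one_mul]

theorem sum_w_left (i j : ι) (a : κ) : ∑ b, w P Q (i, a) (j, b) = left P Q a (P.u i j) := by
  simp only [w_apply, ← Finset.mul_sum, ← map_sum, Q.magic.row_sum, map_one, mul_one]

theorem sum_w_right (i : ι) (a b : κ) : ∑ j, w P Q (i, a) (j, b) = right P Q (Q.u a b) := by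
  simp only [w_apply, ← Finset.sum_mul, ← map_sum, P.magic.row_sum, map_one, one_mul]

theorem w_generates [Nonempty ι] : (StarAlgebra.adjoin ℂ
    (Set.range fun p : (ι × κ) × (ι × κ) => w P Q p.1 p.2)).topologicalClosure = ⊤ := by
  set S := (StarAlgebra.adjoin ℂ
    (Set.range fun p : (ι × κ) × (ι × κ) => w P Q p.1 p.2)).topologicalClosure with hS
  have hcl : IsClosed (S : Set (Wreath P Q)) := StarSubalgebra.isClosed_topologicalClosure _
  have hw : ∀ p q, w P Q p q ∈ S := fun p q =>
    StarSubalgebra.le_topologicalClosure _ (StarAlgebra.subset_adjoin ℂ _ ⟨(p, q), rfl⟩)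
  refine top_unique fun x _ => Relations.Univ.mem_of_closed _ _ hcl (fun g => ?_) x
  rcases g with ⟨a, y⟩ | y
  · refine P.mem_of_closed (S.comap (left P Q a)) (hcl.preimage (map_continuous (left P Q a)))
      (fun i j => ?_) y
    refine StarSubalgebra.mem_comap _ _ _ |>.2 ?_
    rw [← sum_w_left]
    exact sum_mem fun b _ => hw _ _
  · refine Q.mem_of_closed (S.comap (right P Q)) (hcl.preimage (map_continuous (right P Q)))
      (fun a b => ?_) y
    refine StarSubalgebra.mem_comap _ _ _ |>.2 ?_
    rw [← sum_w_right P Q (Classical.arbitrary ι)]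
    exact sum_mem fun b _ => hw _ _

/-! The comultiplication `Δ(u^(a) i j) = ∑ k c, u^(a) i k * v a c ⊗ u^(c) k j`,
`Δ(v a b) = ∑ c, v a c ⊗ v c b`. -/

theorem comul_commute (a c : κ) (x : P.A) :
    Commute (Tensor.map (left P Q a) (left P Q c) (P.comul x))
      (Tensor.inl _ (Wreath P Q) (right P Q (Q.u a c))) := by
  refine P.commute_of ((Tensor.map (left P Q a) (left P Q c)).comp P.comul) _ ?_ (fun i j => ?_) x
  · rw [← map_star, ← map_star, (Q.magic.proj a c).isSelfAdjoint.star_eq]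
  · rw [StarAlgHom.comp_apply, P.comul_u, map_sum]
    refine Commute.sum_left _ _ _ fun k _ => ?_
    rw [Tensor.map_tmul]
    exact ((commute P Q a c (P.u i k)).map (Tensor.inl (Wreath P Q) (Wreath P Q))).mul_left
      (Tensor.commute _ _ _ _).symm

/-- The comultiplication on the `a`-th copy of `A`. -/
def comulLeft (a : κ) : P.A →⋆ₐ[ℂ] Tensor (Wreath P Q) (Wreath P Q) :=
  glue (fun c => (Tensor.map (left P Q a) (left P Q c)).comp P.comul)
    (fun c => Tensor.inl _ _ (right P Q (Q.u a c)))
    (fun c => ((Q.magic.proj a c).map (right P Q)).map (Tensor.inl _ _))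
    (fun b c h => by rw [← map_mul, ← map_mul, Q.magic.row_orthogonal a b c h, map_zero, map_zero])
    (by simp only [← map_sum, Q.magic.row_sum, map_one])
    (fun c x => comul_commute P Q a c x)

theorem comulLeft_u (a : κ) (i j : ι) : comulLeft P Q a (P.u i j) =
    ∑ c, (∑ k, Tensor.tmul (left P Q a (P.u i k)) (left P Q c (P.u k j))) *
      Tensor.inl _ _ (right P Q (Q.u a c)) := by
  change ∑ c, Tensor.map (left P Q a) (left P Q c) (P.comul (P.u i j)) *
      Tensor.inl _ _ (right P Q (Q.u a c)) = _
  simp only [P.comul_u, map_sum, Tensor.map_tmul]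

/-- The comultiplication on the copy of `B`. -/
def comulRight : Q.A →⋆ₐ[ℂ] Tensor (Wreath P Q) (Wreath P Q) :=
  (Tensor.map (right P Q) (right P Q)).comp Q.comul

theorem comulRight_u (a b : κ) : comulRight P Q (Q.u a b) =
    ∑ c, Tensor.tmul (right P Q (Q.u a c)) (right P Q (Q.u c b)) := by
  rw [comulRight, StarAlgHom.comp_apply, Q.comul_u, map_sum]
  simp only [Tensor.map_tmul]

theorem tmul_aux {C : Type} [CStarAlgebra C] (x x' y z : C) (hx : x' * x' = x') :
    Tensor.tmul x y * Tensor.inl C C x' * Tensor.tmul x' z =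
      Tensor.tmul (x * x') (y * z) := by
  have h1 := (Tensor.commute C C x' y).eq
  simp only [Tensor.tmul, map_mul]
  calc Tensor.inl C C x * Tensor.inr C C y * Tensor.inl C C x' *
        (Tensor.inl C C x' * Tensor.inr C C z)
      = Tensor.inl C C x * (Tensor.inr C C y * Tensor.inl C C (x' * x')) * Tensor.inr C C z := by
        simp only [map_mul, mul_assoc]
    _ = _ := by rw [hx, ← h1]; simp only [mul_assoc]

theorem tmul_aux' {C : Type} [CStarAlgebra C] (t : Tensor C C) (x x' y : C) (hx : x * x' = 0) :
    t * Tensor.inl C C x * Tensor.tmul x' y = 0 := by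
  rw [Tensor.tmul, mul_assoc, ← mul_assoc (Tensor.inl C C x), ← map_mul, hx, map_zero, zero_mul,
    mul_zero]

theorem comul_mul (a b : κ) (i j : ι) : comulLeft P Q a (P.u i j) * comulRight P Q (Q.u a b) =
    ∑ c, ∑ k, Tensor.tmul (left P Q a (P.u i k) * right P Q (Q.u a c))
      (left P Q c (P.u k j) * right P Q (Q.u c b)) := by
  rw [comulLeft_u, comulRight_u, Finset.sum_mul_sum]
  refine Finset.sum_congr rfl fun c _ => ?_
  rw [Finset.sum_eq_single c]
  · rw [Finset.sum_mul, Finset.sum_mul]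
    refine Finset.sum_congr rfl fun k _ => ?_
    exact tmul_aux _ _ _ _ (by rw [← map_mul, (Q.magic.proj a c).isIdempotentElem.eq])
  · intro d _ hd
    exact tmul_aux' _ _ _ _ (by rw [← map_mul, Q.magic.row_orthogonal a c d hd.symm, map_zero])
  · intro h; exact absurd (Finset.mem_univ c) h

theorem star_w (p q : ι × κ) : star (w P Q p q) = w P Q p q :=
  ((w_magic P Q).proj p q).isSelfAdjoint

theorem star_tmul {C : Type} [CStarAlgebra C] (x y : C) :
    star (Tensor.tmul x y) = Tensor.tmul (star x) (star y) := by
  rw [Tensor.tmul, star_mul, ← map_star, ← map_star, ← (Tensor.commute C C _ _).eq, Tensor.tmul]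

theorem comul_mul_comm (a b : κ) (i j : ι) :
    Commute (comulLeft P Q a (P.u i j)) (comulRight P Q (Q.u a b)) := by
  have h := comul_mul P Q a b i j
  have e1 : star (comulLeft P Q a (P.u i j)) = comulLeft P Q a (P.u i j) := by
    rw [← map_star, (P.magic.proj i j).isSelfAdjoint.star_eq]
  have e2 : star (comulRight P Q (Q.u a b)) = comulRight P Q (Q.u a b) := by
    rw [← map_star, (Q.magic.proj a b).isSelfAdjoint.star_eq]
  have e3 : star (comulLeft P Q a (P.u i j) * comulRight P Q (Q.u a b)) =
      comulLeft P Q a (P.u i j) * comulRight P Q (Q.u a b) := by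
    rw [h]
    simp only [star_sum, star_tmul, ← w_apply, star_w]
  rw [star_mul, e1, e2] at e3
  exact e3.symm

/-! The antipode: `S(u^(a) i j) = ∑ c, u^(c) j i * v c a` and `S(v a b) = v b a`. -/

/-- The `*`-homomorphism between the opposite algebras. -/
def opHom {A C : Type} [CStarAlgebra A] [CStarAlgebra C] (φ : A →⋆ₐ[ℂ] C) : Aᵐᵒᵖ →⋆ₐ[ℂ] Cᵐᵒᵖ where
  toFun x := MulOpposite.op (φ x.unop)
  map_one' := by simp
  map_mul' x y := by simp
  map_zero' := by simp
  map_add' x y := by simp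
  commutes' c := by simp [MulOpposite.algebraMap_apply, AlgHomClass.commutes]
  map_star' x := by simp [map_star]

/-- The antipode on the `a`-th copy of `A`. -/
def antipodeLeft (a : κ) : P.A →⋆ₐ[ℂ] (Wreath P Q)ᵐᵒᵖ :=
  glue (fun c => (opHom (left P Q c)).comp P.antipode)
    (fun c => opHom (right P Q) (MulOpposite.op (Q.u c a)))
    (fun c => IsStarProjection.map (f := opHom (right P Q))
      ⟨congrArg MulOpposite.op (Q.magic.proj c a).isIdempotentElem.eq,
        congrArg MulOpposite.op (Q.magic.proj c a).isSelfAdjoint.star_eq⟩)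
    (fun b c h => by
      rw [← map_mul, ← MulOpposite.op_mul, Q.magic.col_orthogonal c a b h.symm,
        MulOpposite.op_zero, map_zero])
    (by rw [← map_sum, ← Finset.op_sum, Q.magic.col_sum, MulOpposite.op_one, map_one])
    (fun c x => congrArg MulOpposite.op (commute P Q c a (P.antipode x).unop).eq.symm)

theorem antipodeLeft_u (a : κ) (i j : ι) : antipodeLeft P Q a (P.u i j) =
    ∑ c, MulOpposite.op (right P Q (Q.u c a) * left P Q c (P.u j i)) := by
  change ∑ c, MulOpposite.op (left P Q c (P.antipode (P.u i j)).unop) *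
    MulOpposite.op (right P Q (Q.u c a)) = _
  simp only [P.antipode_u, MulOpposite.unop_op, MulOpposite.op_mul]

/-- The antipode on the copy of `B`. -/
def antipodeRight : Q.A →⋆ₐ[ℂ] (Wreath P Q)ᵐᵒᵖ := (opHom (right P Q)).comp Q.antipode

theorem antipodeRight_u (a b : κ) :
    antipodeRight P Q (Q.u a b) = MulOpposite.op (right P Q (Q.u b a)) := by
  change MulOpposite.op (right P Q (Q.antipode (Q.u a b)).unop) = _
  rw [Q.antipode_u, MulOpposite.unop_op]

theorem antipode_mul (a b : κ) (i j : ι) :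
    antipodeLeft P Q a (P.u i j) * antipodeRight P Q (Q.u a b) =
      MulOpposite.op (w P Q (j, b) (i, a)) := by
  rw [antipodeLeft_u, antipodeRight_u, Finset.sum_mul, Finset.sum_eq_single b]
  · rw [← MulOpposite.op_mul, ← mul_assoc, ← map_mul, (Q.magic.proj b a).isIdempotentElem.eq,
      ← (commute P Q b a _).eq, w_apply]
  · intro c _ hc
    rw [← MulOpposite.op_mul, ← mul_assoc, ← map_mul, Q.magic.col_orthogonal b a c hc.symm,
      map_zero, zero_mul, MulOpposite.op_zero]
  · intro h; exact absurd (Finset.mem_univ b) h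

theorem antipode_mul_comm (a b : κ) (i j : ι) :
    Commute (antipodeLeft P Q a (P.u i j)) (antipodeRight P Q (Q.u a b)) := by
  have e1 : star (antipodeLeft P Q a (P.u i j)) = antipodeLeft P Q a (P.u i j) := by
    rw [← map_star, (P.magic.proj i j).isSelfAdjoint.star_eq]
  have e2 : star (antipodeRight P Q (Q.u a b)) = antipodeRight P Q (Q.u a b) := by
    rw [← map_star, (Q.magic.proj a b).isSelfAdjoint.star_eq]
  have e3 : star (antipodeLeft P Q a (P.u i j) * antipodeRight P Q (Q.u a b)) =
      antipodeLeft P Q a (P.u i j) * antipodeRight P Q (Q.u a b) := by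
    rw [antipode_mul, ← MulOpposite.op_star, star_w]
  rw [star_mul, e1, e2] at e3
  exact e3.symm

end Wreath

open Wreath in
/-- The free wreath product `A *_w B` of `(A, u)` and `(B, v)`: the universal C*-algebra generated by
copies `A^(a)` of `A`, indexed by the index set `κ` of `v`, and a copy of `B`, with the relations
`[u^(a) i j, v a b] = 0`, and with the magic unitary `w (i, a) (j, b) = u^(a) i j * v a b`. -/
def freeWreath [Nonempty ι] : QuantumPermGroup (ι × κ) where
  A := Wreath P Q
  u := w P Q
  magic := w_magic P Q
  generates := w_generates P Q
  comul := Wreath.lift (comulLeft P Q) (comulRight P Q)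
    fun i j a b => comul_mul_comm P Q a b i j
  comul_u := by
    rintro ⟨i, a⟩ ⟨j, b⟩
    rw [w_apply, map_mul, lift_left, lift_right, comul_mul, Fintype.sum_prod_type_right]
    rfl
  counit := Wreath.lift (fun _ => P.counit) Q.counit fun _ _ _ _ => Commute.all _ _
  counit_u := by
    rintro ⟨i, a⟩ ⟨j, b⟩
    rw [w_apply, map_mul, lift_left, lift_right, P.counit_u, Q.counit_u]
    by_cases h1 : i = j <;> by_cases h2 : a = b <;> simp [h1, h2]
  antipode := Wreath.lift (antipodeLeft P Q) (antipodeRight P Q)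
    fun i j a b => antipode_mul_comm P Q a b i j
  antipode_u := by
    rintro ⟨i, a⟩ ⟨j, b⟩
    rw [w_apply, map_mul, lift_left, lift_right, antipode_mul]

end FreeWreath

/-- An isomorphism of quantum permutation groups, at the level of Hopf C*-algebras: an isomorphism of
C*-algebras which identifies the magic unitaries, the comultiplications, the counits and the
antipodes. -/
structure QuantumPermGroup.Iso {ι : Type} [Fintype ι] [DecidableEq ι]
    (P Q : QuantumPermGroup ι) where
  toEquiv : P.A ≃⋆ₐ[ℂ] Q.A
  map_u : ∀ i j, toEquiv (P.u i j) = Q.u i j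
  map_comul : ∀ x, Q.comul (toEquiv x) =
    Tensor.map (toEquiv : P.A →⋆ₐ[ℂ] Q.A) (toEquiv : P.A →⋆ₐ[ℂ] Q.A) (P.comul x)
  map_counit : ∀ x, Q.counit (toEquiv x) = P.counit x
  map_antipode : ∀ x, Q.antipode (toEquiv x) = MulOpposite.op (toEquiv (P.antipode x).unop)

end QAut

end

/-! Write `d_X`, `d_Y` for the adjacency matrices, `J` for the all-ones matrix on the vertices of
`X`, and `d` for the valence of `X`. The lexicographic product has adjacency matrix `D = d_X ⊗ 1 + J
⊗ d_Y`. Everything rests on showing that a magic unitary `U` commuting with `D` commutes with each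
summand separately; the spectral hypothesis serves only this purpose.

Let `P = J / n` and `E = P ⊗ 1`. On the range of `E`, `D` acts as `1 ⊗ N` with `N = d + n d_Y`; on
the complement it acts as `d_X ⊗ 1`. Let `p` be the product of `x - λ` over the eigenvalues `λ ≠ d`
of `d_X`. Connectedness makes `p(d_X)` a multiple of `J` (`exists_hoffman_polynomial`), so `p(D)`
vanishes on the complement and `p(D) = P ⊗ p(N)`. The eigenvalues of `N` are the numbers `d + n μ`,
and the hypothesis says that none of them is a root of `p`, so `p(N)` is invertible
(`isUnit_aeval_of_notMem_spectrum`). Hence `p(D)` has a generalized inverse with support `E`, and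
whatever commutes with `D` commutes with `E` (`commute_of_generalized_inverse`,
`allOnes_kronecker_one_mem`). Multiplying `D` by `J ⊗ 1` then isolates `J ⊗ d_Y`, and subtraction
gives `d_X ⊗ 1` (`adjMatrix_kronecker_mem`).

Commuting with `J ⊗ 1` means that the row and column sums of every block of `U` agree
(`BlockInvariant`). Their common value defines `v a b`, and summing over the other column index
defines `u^(a) i j`. Both matrices are magic, they commute with `d_Y` and `d_X` respectively, and
`u^(a) i j * v a b` recovers `U (i, a) (j, b)` in either order. So the relations of the free wreath
product hold inside the algebra of `X ∘ Y`. Conversely the matrix `w` of the free wreath product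
commutes with `D` (`commute_adjMatrix_lexProd`). The two universal properties give morphisms that
are mutually inverse on generators, and the Hopf structure follows because it is determined there.
-/

namespace QAut

set_option linter.unusedSectionVars false

/-! ### Adjacency matrices of regular graphs and of lexicographic products -/

section Spectral

open Matrix Polynomial
open scoped Kronecker

variable {V W : Type} [Fintype V] [DecidableEq V] [Fintype W] [DecidableEq W]

/-- The all-ones matrix. -/
def allOnes (V : Type) : Matrix V V ℝ := Matrix.of fun _ _ => 1

theorem allOnes_mul_self : allOnes V * allOnes V = (Fintype.card V : ℝ) • allOnes V := by
  ext i j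
  simp [allOnes, Matrix.mul_apply]

theorem adjMatrix_mul_allOnes (X : SimpleGraph V) [DecidableRel X.Adj] {d : ℕ}
    (hX : X.IsRegularOfDegree d) : X.adjMatrix ℝ * allOnes V = (d : ℝ) • allOnes V := by
  ext i j
  simp [allOnes, SimpleGraph.adjMatrix_mul_apply, hX i]

theorem allOnes_mul_adjMatrix (X : SimpleGraph V) [DecidableRel X.Adj] {d : ℕ}
    (hX : X.IsRegularOfDegree d) : allOnes V * X.adjMatrix ℝ = (d : ℝ) • allOnes V := by
  ext i j
  simp [allOnes, SimpleGraph.mul_adjMatrix_apply, hX j]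

/-- For a connected regular graph, a real matrix annihilated by `d - valence` from the left has
constant columns. -/
theorem apply_eq_of_adjMatrix_mul_eq_smul (X : SimpleGraph V) [DecidableRel X.Adj] {d : ℕ}
    (hX : X.IsRegularOfDegree d) (hconn : X.Connected) {M : Matrix V V ℝ}
    (hM : X.adjMatrix ℝ * M = (d : ℝ) • M) (i j k : V) : M i k = M j k := by
  -- By regularity `d - d_X` is the Laplacian, whose kernel consists of the functions constant on
  -- connected components.
  have h : X.lapMatrix ℝ *ᵥ (fun i => M i k) = 0 := by
    ext i
    have h' := congrFun (congrFun hM i) k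
    rw [SimpleGraph.adjMatrix_mul_apply, Matrix.smul_apply, smul_eq_mul] at h'
    rw [SimpleGraph.lapMatrix_mulVec_apply, h', hX i, sub_self, Pi.zero_apply]
  exact (X.lapMatrix_mulVec_eq_zero_iff_forall_reachable.1 h) i j (hconn.preconnected i j)

/-- The Hoffman polynomial of a connected regular graph: a product of linear factors whose roots are
the eigenvalues other than the valence and whose value at the adjacency matrix is a multiple of the
all-ones matrix. -/
theorem exists_hoffman_polynomial [Nonempty V] (X : SimpleGraph V) [DecidableRel X.Adj] {d : ℕ}
    (hX : X.IsRegularOfDegree d) (hconn : X.Connected) :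
    ∃ s : Finset ℝ, (∀ l ∈ s, l ∈ spectrum ℝ (X.adjMatrix ℝ) ∧ l ≠ d) ∧
      ∃ c : ℝ, aeval (X.adjMatrix ℝ) (∏ l ∈ s, (Polynomial.X - C l)) = c • allOnes V := by
  set A := X.adjMatrix ℝ with hA
  have hH : A.IsHermitian := X.isHermitian_adjMatrix ℝ
  have hfin : (spectrum ℝ A).Finite := Matrix.finite_real_spectrum
  refine ⟨hfin.toFinset.erase d, fun l hl => ?_, ?_⟩
  · rw [Finset.mem_erase, Set.Finite.mem_toFinset] at hl
    exact ⟨hl.2, hl.1⟩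
  set p := ∏ l ∈ hfin.toFinset.erase (d : ℝ), (Polynomial.X - C l) with hp
  -- The polynomial vanishes at every eigenvalue, and a symmetric matrix is diagonalizable, so
  -- simple roots suffice; the functional calculus expresses this.
  have hkill : aeval A ((Polynomial.X - C (d : ℝ)) * p) = 0 := by
    rw [← cfc_polynomial (R := ℝ) _ A hH.isSelfAdjoint, ← cfc_zero ℝ A]
    refine cfc_congr fun x hx => ?_
    rw [Polynomial.eval_mul, hp, eval_prod]
    by_cases h : x = d
    · simp [h]
    · rw [Finset.prod_eq_zero (i := x) (by simp [h, hx]) (by simp), mul_zero]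
      rfl
  have hmul : A * aeval A p = (d : ℝ) • aeval A p := by
    rw [map_mul, map_sub, aeval_X, aeval_C, sub_mul, sub_eq_zero] at hkill
    rw [hkill, Algebra.smul_def]
  -- Constant columns together with symmetry force all entries of `aeval A p` to coincide.
  have hcol := apply_eq_of_adjMatrix_mul_eq_smul X hX hconn hmul
  have hsymm : (aeval A p)ᵀ = aeval A p := by
    have h : IsSelfAdjoint (aeval A p) := by
      rw [← cfc_polynomial (R := ℝ) _ A hH.isSelfAdjoint]
      exact cfc_predicate _ _
    have h' := h.star_eq
    rwa [star_eq_conjTranspose, conjTranspose_eq_transpose_of_trivial] at h'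
  let v : V := Classical.arbitrary V
  refine ⟨aeval A p v v, ?_⟩
  ext i j
  rw [hcol i v j, ← hsymm, transpose_apply, hcol j v v]
  simp [allOnes]

/-- The adjacency matrix of `X ∘ Y` is `d_X ⊗ 1 + J ⊗ d_Y`. -/
theorem adjMatrix_lexProd (X : SimpleGraph V) [DecidableRel X.Adj] (Y : SimpleGraph W)
    [DecidableRel Y.Adj] : (lexProd X Y).adjMatrix ℝ =
      X.adjMatrix ℝ ⊗ₖ 1 + allOnes V ⊗ₖ Y.adjMatrix ℝ := by
  ext ⟨i, a⟩ ⟨j, b⟩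
  rw [SimpleGraph.adjMatrix_apply]
  by_cases h : a = b
  · subst h
    simp [SimpleGraph.adjMatrix_apply, lexProd, allOnes]
  · simp [SimpleGraph.adjMatrix_apply, lexProd, allOnes, h]

/-! ### Polynomials in Kronecker products and their invertibility. -/

theorem aeval_kronecker_one (M : Matrix V V ℝ) (p : ℝ[X]) :
    aeval (M ⊗ₖ (1 : Matrix W W ℝ)) p = aeval M p ⊗ₖ (1 : Matrix W W ℝ) := by
  induction p using Polynomial.induction_on with
  | C r =>
    simp [Algebra.algebraMap_eq_smul_one, smul_kronecker]
  | add p q hp hq => simp only [map_add, hp, hq, add_kronecker]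
  | monomial n r h =>
    rw [pow_succ, ← mul_assoc, map_mul, h, map_mul _ (_ * _), aeval_X, aeval_X, ← mul_kronecker_mul,
      one_mul]

theorem aeval_one_kronecker (M : Matrix W W ℝ) (p : ℝ[X]) :
    aeval ((1 : Matrix V V ℝ) ⊗ₖ M) p = (1 : Matrix V V ℝ) ⊗ₖ aeval M p := by
  induction p using Polynomial.induction_on with
  | C r =>
    simp [Algebra.algebraMap_eq_smul_one, kronecker_smul]
  | add p q hp hq => simp only [map_add, hp, hq, kronecker_add]
  | monomial n r h =>
    rw [pow_succ, ← mul_assoc, map_mul, h, map_mul _ (_ * _), aeval_X, aeval_X, ← mul_kronecker_mul,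
      one_mul]

/-- An intertwiner of `x` and `y` intertwines their powers, hence their polynomials. It is used with
`z = E` and `z = 1 - E`, where the adjacency matrix of the lexicographic product is replaced by a
simpler one. -/
theorem aeval_mul_of_mul_eq {R : Type} [Ring R] [Algebra ℝ R] {x y z : R} (h : x * z = z * y)
    (p : ℝ[X]) : aeval x p * z = z * aeval y p := by
  induction p using Polynomial.induction_on with
  | C r => simp [Algebra.commutes]
  | add p q hp hq => simp only [map_add, add_mul, mul_add, hp, hq]
  | monomial n r hn =>
    rw [pow_succ, ← mul_assoc, map_mul _ (_ * _), map_mul _ (_ * _), aeval_X, aeval_X, mul_assoc, h, ← mul_assoc, hn,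
      mul_assoc]

/-- A product of linear factors, at `r + n • M`, is invertible if `(l - r) / n` is not an eigenvalue
of `M` for any of the roots `l`. -/
theorem isUnit_aeval_of_notMem_spectrum (M : Matrix W W ℝ) (s : Finset ℝ) {r n : ℝ} (hn : n ≠ 0)
    (h : ∀ l ∈ s, ∀ m ∈ spectrum ℝ M, r - l ≠ -(n * m)) :
    IsUnit (aeval (algebraMap ℝ (Matrix W W ℝ) r + n • M) (∏ l ∈ s, (Polynomial.X - C l))) := by
  by_contra hu
  -- The product is rewritten as one over its own multiset of roots, the form in which spectral
  -- mapping yields an eigenvalue that is also a root.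
  rw [← Finset.prod_map_val, ← roots_prod_X_sub_C s] at hu
  obtain ⟨k, hk, hk0⟩ := spectrum.exists_mem_of_not_isUnit_aeval_prod hu
  obtain ⟨l, hl, hkl⟩ := Finset.prod_eq_zero_iff.1 ((eval_prod _ _ _).symm.trans hk0)
  obtain rfl : k = l := by simpa [sub_eq_zero] using hkl
  -- The eigenvalues of `r + n • M` are the numbers `r + n * m` with `m` an eigenvalue of `M`.
  rw [← spectrum.singleton_add_eq, Set.singleton_add] at hk
  obtain ⟨t, ht, rfl⟩ := hk
  have h2 := spectrum.unit_smul_eq_smul M (Units.mk0 n hn)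
  rw [show (Units.mk0 n hn) • M = n • M from rfl] at h2
  rw [h2] at ht
  obtain ⟨m, hm, rfl⟩ := ht
  refine h _ hl m hm ?_
  change r - (r + n * m) = _
  ring

end Spectral

/-- Let `g` and `k` be generalized inverses of each other with `e = g k = k g`. Whatever commutes
with `k` commutes with `e`. -/
theorem commute_of_generalized_inverse {R : Type} [Ring R] {e k g u : R} (hgk : g * k = e)
    (hkg : k * g = e) (hek : e * k = k) (hke : k * e = k) (hu : Commute k u) : Commute e u := by
  -- Only `k` is known to commute with `u`, not `g`. Hence `e * u` and `u * e` are each reduced to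
  -- the compression `e * u * e`, by absorbing `e` into `k`.
  have h1 : e * u = e * u * e := by
    calc e * u = g * (k * u) := by rw [← hgk, mul_assoc]
      _ = g * (u * (k * e)) := by rw [hu.eq, hke]
      _ = g * (k * u) * e := by rw [hu.eq]; simp only [mul_assoc]
      _ = e * u * e := by rw [← hgk]; simp only [mul_assoc]
  have h2 : u * e = e * u * e := by
    calc u * e = (u * k) * g := by rw [← hkg, mul_assoc]
      _ = (e * k) * u * g := by rw [← hu.eq, hek]
      _ = e * (k * u) * g := by simp only [mul_assoc]
      _ = e * u * e := by rw [hu.eq, ← hkg]; simp only [mul_assoc]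
  exact h1.trans h2.symm

/-! ### Separating the two summands of the adjacency matrix of the lexicographic product. -/

section LexProd

open Matrix Polynomial
open scoped Kronecker

variable {V W : Type} [Fintype V] [DecidableEq V] [Fintype W] [DecidableEq W]

/-- The elements of a matrix algebra which, read in a complex algebra, commute with `u`. -/
def realCentralizer {ι A : Type} [Fintype ι] [DecidableEq ι] [Ring A] [Algebra ℝ A]
    (u : Matrix ι ι A) : Subalgebra ℝ (Matrix ι ι ℝ) :=
  (Subalgebra.centralizer ℝ {u}).comap (Algebra.ofId ℝ A).mapMatrix

theorem mem_realCentralizer {ι A : Type} [Fintype ι] [DecidableEq ι] [Ring A] [Algebra ℝ A]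
    {u : Matrix ι ι A} {M : Matrix ι ι ℝ} :
    M ∈ realCentralizer u ↔ Commute (M.map (algebraMap ℝ A)) u := by
  rw [realCentralizer, Subalgebra.mem_comap, Subalgebra.mem_centralizer_iff]
  simp only [Set.mem_singleton_iff, forall_eq]
  exact eq_comm

/-- Under the spectral hypothesis, whatever commutes with the adjacency matrix of `X ∘ Y` commutes
with `J ⊗ 1`. -/
theorem allOnes_kronecker_one_mem [Nonempty V] (X : SimpleGraph V) [DecidableRel X.Adj]
    (Y : SimpleGraph W) [DecidableRel Y.Adj] {d : ℕ} (hX : X.IsRegularOfDegree d)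
    (hconn : X.Connected)
    (hspec : ∀ l ∈ spectrum ℝ (X.adjMatrix ℝ), l ≠ d → ∀ m ∈ spectrum ℝ (Y.adjMatrix ℝ),
      (d : ℝ) - l ≠ -(Fintype.card V * m))
    {A : Type} [Ring A] [Algebra ℝ A] {u : Matrix (V × W) (V × W) A}
    (hu : (lexProd X Y).adjMatrix ℝ ∈ realCentralizer u) :
    allOnes V ⊗ₖ (1 : Matrix W W ℝ) ∈ realCentralizer u := by
  have hn : (Fintype.card V : ℝ) ≠ 0 := Nat.cast_ne_zero.2 Fintype.card_ne_zero
  obtain ⟨s, hs, c, hc⟩ := exists_hoffman_polynomial X hX hconn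
  set p := ∏ l ∈ s, (Polynomial.X - C l) with hp
  set n : ℝ := (Fintype.card V : ℝ) with hnd
  set N := algebraMap ℝ (Matrix W W ℝ) d + n • Y.adjMatrix ℝ with hN
  obtain ⟨B, hB⟩ := isUnit_aeval_of_notMem_spectrum (Y.adjMatrix ℝ) s (r := d) hn
    fun l hl m hm => hspec l (hs l hl).1 (hs l hl).2 m hm
  rw [← hp, ← hN] at hB
  set D := (lexProd X Y).adjMatrix ℝ with hD
  rw [adjMatrix_lexProd] at hD
  set E := (n⁻¹ • allOnes V) ⊗ₖ (1 : Matrix W W ℝ) with hE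
  have hJ : allOnes V * allOnes V = n • allOnes V := allOnes_mul_self
  have hP : (n⁻¹ • allOnes V) * (n⁻¹ • allOnes V) = n⁻¹ • allOnes V := by
    rw [smul_mul_smul_comm, hJ, smul_smul, mul_assoc, inv_mul_cancel₀ hn, mul_one]
  -- On vectors constant along each copy of `X`, `d_X` acts as its valence and `J` as `n`.
  have h1 : D * E = E * ((1 : Matrix V V ℝ) ⊗ₖ N) := by
    rw [hD, hE, add_mul, ← mul_kronecker_mul, ← mul_kronecker_mul, ← mul_kronecker_mul, one_mul,
      mul_one, mul_one, one_mul, mul_smul_comm, mul_smul_comm, hJ, adjMatrix_mul_allOnes X hX,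
      hN, Algebra.algebraMap_eq_smul_one, kronecker_add, kronecker_smul, kronecker_smul,
      smul_kronecker, smul_kronecker, smul_kronecker, smul_kronecker, smul_kronecker,
      smul_kronecker, smul_comm n⁻¹ (d : ℝ), smul_comm n⁻¹ n]
  -- On the complement `J` vanishes, so only the summand `d_X ⊗ 1` survives.
  have h2 : D * (1 - E) = (1 - E) * (X.adjMatrix ℝ ⊗ₖ (1 : Matrix W W ℝ)) := by
    rw [hD, hE, add_mul, mul_sub, mul_sub, sub_mul, ← mul_kronecker_mul, ← mul_kronecker_mul,
      ← mul_kronecker_mul, one_mul, mul_one, mul_one, mul_one, one_mul, mul_smul_comm,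
      mul_smul_comm, smul_mul_assoc, hJ, adjMatrix_mul_allOnes X hX, allOnes_mul_adjMatrix X hX,
      smul_smul n⁻¹ n, inv_mul_cancel₀ hn, one_smul, sub_self, add_zero]
  have h3 := aeval_mul_of_mul_eq h1 p
  have h4 := aeval_mul_of_mul_eq h2 p
  rw [aeval_one_kronecker, ← hB] at h3
  -- Since `p(d_X) = c J`, this kills `p(D) (1 - E)`, so that `p(D) = p(D) E`.
  have h5 : (1 - E) * (c • allOnes V) ⊗ₖ (1 : Matrix W W ℝ) = 0 := by
    rw [sub_mul, one_mul, hE, ← mul_kronecker_mul, one_mul, smul_mul_smul_comm, hJ, smul_smul,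
      mul_right_comm, inv_mul_cancel₀ hn, one_mul, sub_self]
  rw [aeval_kronecker_one, hc, h5, mul_sub, mul_one, sub_eq_zero, h3] at h4
  have hK : aeval D p = (n⁻¹ • allOnes V) ⊗ₖ (B : Matrix W W ℝ) := by
    rw [h4, hE, ← mul_kronecker_mul, mul_one, one_mul]
  have hKmem : aeval D p ∈ realCentralizer u :=
    Algebra.adjoin_le (Set.singleton_subset_iff.2 hu) (aeval_mem_adjoin_singleton ℝ D)
  have hEmem : E ∈ realCentralizer u := by
    rw [mem_realCentralizer] at hKmem ⊢
    let f := (Algebra.ofId ℝ A).mapMatrix (m := V × W)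
    -- As `p(D) = P ⊗ B` with `B` invertible, `P ⊗ B⁻¹` is a generalized inverse with support `E`.
    -- The identities hold over the reals and are transported by the ring morphism `f`.
    refine commute_of_generalized_inverse (e := f E) (k := f (aeval D p))
      (g := f ((n⁻¹ • allOnes V) ⊗ₖ (B⁻¹ : (Matrix W W ℝ)ˣ).1)) ?_ ?_ ?_ ?_ hKmem <;>
    rw [← map_mul, hK, ← mul_kronecker_mul, hP] <;> simp [hE]
  have hscale : allOnes V ⊗ₖ (1 : Matrix W W ℝ) = n • E := by
    rw [hE, smul_kronecker, smul_smul, mul_inv_cancel₀ hn, one_smul]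
  rw [hscale]
  exact Subalgebra.smul_mem _ hEmem n

/-- Under the spectral hypothesis, whatever commutes with the adjacency matrix of `X ∘ Y` commutes
with its two summands `d_X ⊗ 1` and `J ⊗ d_Y`. -/
theorem adjMatrix_kronecker_mem [Nonempty V] (X : SimpleGraph V) [DecidableRel X.Adj]
    (Y : SimpleGraph W) [DecidableRel Y.Adj] {d : ℕ} (hX : X.IsRegularOfDegree d)
    {A : Type} [Ring A] [Algebra ℝ A] {u : Matrix (V × W) (V × W) A}
    (hu : (lexProd X Y).adjMatrix ℝ ∈ realCentralizer u)
    (hJ : allOnes V ⊗ₖ (1 : Matrix W W ℝ) ∈ realCentralizer u) :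
    X.adjMatrix ℝ ⊗ₖ (1 : Matrix W W ℝ) ∈ realCentralizer u ∧
      allOnes V ⊗ₖ Y.adjMatrix ℝ ∈ realCentralizer u := by
  have hn : (Fintype.card V : ℝ) ≠ 0 := Nat.cast_ne_zero.2 Fintype.card_ne_zero
  -- Multiplication by `J ⊗ 1` turns `d_X` into the scalar `d`, leaving `J ⊗ d_Y` as the only
  -- unknown term.
  have h1 : (lexProd X Y).adjMatrix ℝ * (allOnes V ⊗ₖ (1 : Matrix W W ℝ)) =
      (d : ℝ) • (allOnes V ⊗ₖ (1 : Matrix W W ℝ)) +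
        (Fintype.card V : ℝ) • (allOnes V ⊗ₖ Y.adjMatrix ℝ) := by
    rw [adjMatrix_lexProd, add_mul, ← mul_kronecker_mul, ← mul_kronecker_mul, mul_one, mul_one,
      adjMatrix_mul_allOnes X hX, allOnes_mul_self, smul_kronecker, smul_kronecker]
  have h2 : allOnes V ⊗ₖ Y.adjMatrix ℝ = (Fintype.card V : ℝ)⁻¹ •
      ((lexProd X Y).adjMatrix ℝ * (allOnes V ⊗ₖ (1 : Matrix W W ℝ)) -
        (d : ℝ) • (allOnes V ⊗ₖ (1 : Matrix W W ℝ))) := by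
    rw [h1, add_sub_cancel_left, smul_smul, inv_mul_cancel₀ hn, one_smul]
  have h3 : allOnes V ⊗ₖ Y.adjMatrix ℝ ∈ realCentralizer u := by
    rw [h2]
    exact Subalgebra.smul_mem _ (sub_mem (mul_mem hu hJ) (Subalgebra.smul_mem _ hJ _)) _
  refine ⟨?_, h3⟩
  rw [eq_sub_of_add_eq (adjMatrix_lexProd X Y).symm]
  exact sub_mem hu h3

end LexProd

/-! ### Blocks of a magic unitary -/

section Blocks

variable {V W A : Type} [Fintype V] [DecidableEq V] [Fintype W] [DecidableEq W] [CStarAlgebra A]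

/-- A sum of pairwise orthogonal projections is a projection. -/
theorem isStarProjection_sum {ι : Type} [Fintype ι] {p : ι → A}
    (hp : ∀ i, IsStarProjection (p i)) (h : ∀ i j, i ≠ j → p i * p j = 0) :
    IsStarProjection (∑ i, p i) where
  isIdempotentElem := by
    classical
    rw [IsIdempotentElem, Finset.sum_mul_sum]
    refine Finset.sum_congr rfl fun i _ => ?_
    rw [Finset.sum_eq_single i (fun j _ hj => h i j hj.symm) (fun h => absurd (Finset.mem_univ i) h),
      (hp i).isIdempotentElem.eq]
  isSelfAdjoint := by
    rw [IsSelfAdjoint, star_sum]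
    exact Finset.sum_congr rfl fun i _ => (hp i).isSelfAdjoint.star_eq

/-- The sums of the entries of a matrix indexed by pairs over the second column index. -/
def blockLeft (U : Matrix (V × W) (V × W) A) (a : W) : Matrix V V A :=
  Matrix.of fun i j => ∑ b, U (i, a) (j, b)

/-- The sums of the entries of a matrix indexed by pairs over the first column index. -/
def blockRight (U : Matrix (V × W) (V × W) A) (i : V) : Matrix W W A :=
  Matrix.of fun a b => ∑ j, U (i, a) (j, b)

theorem blockLeft_apply (U : Matrix (V × W) (V × W) A) (a : W) (i j : V) :
    blockLeft U a i j = ∑ b, U (i, a) (j, b) := rfl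

theorem blockRight_apply (U : Matrix (V × W) (V × W) A) (i : V) (a b : W) :
    blockRight U i a b = ∑ j, U (i, a) (j, b) := rfl

variable {U : Matrix (V × W) (V × W) A}

/-- The entries of row `(i, a)` are orthogonal, and `blockRight U i a c` sums those with second
column index `c`, so it acts as an indicator on that row. -/
theorem mul_blockRight_self (hU : IsMagicUnitary U) (i j : V) (a b c : W) :
    U (i, a) (j, b) * blockRight U i a c = if b = c then U (i, a) (j, b) else 0 := by
  rw [blockRight_apply, Finset.mul_sum]
  by_cases h : b = c
  · subst h
    simp [hU.entry_mul]
  · simp [hU.entry_mul, h]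

theorem blockRight_self_mul (hU : IsMagicUnitary U) (i j : V) (a b c : W) :
    blockRight U i a c * U (i, a) (j, b) = if c = b then U (i, a) (j, b) else 0 := by
  rw [blockRight_apply, Finset.sum_mul]
  by_cases h : c = b
  · subst h
    simp [hU.entry_mul]
  · simp [hU.entry_mul, h]

/-- The row sums of the blocks of `U` coincide with the column sums. -/
def BlockInvariant (U : Matrix (V × W) (V × W) A) : Prop :=
  ∀ i j a b, ∑ k, U (i, a) (k, b) = ∑ k, U (k, a) (j, b)

theorem blockRight_eq_sum (hB : BlockInvariant U) (i j : V) (a b : W) :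
    blockRight U i a b = ∑ k, U (k, a) (j, b) := hB i j a b

/-- A column sum of a block does not see the row index, so equality with it removes the dependence
on `i`. This makes a single matrix `v` available for all rows. -/
theorem blockRight_eq (hB : BlockInvariant U) (i j : V) : blockRight U i = blockRight U j := by
  ext a b
  rw [blockRight_eq_sum hB i i, blockRight_eq_sum hB j i]

theorem mul_blockRight (hU : IsMagicUnitary U) (hB : BlockInvariant U) (i j k : V) (a b c : W) :
    U (i, a) (j, b) * blockRight U k a c = if b = c then U (i, a) (j, b) else 0 := by
  rw [blockRight_eq hB k i, mul_blockRight_self hU]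

theorem blockRight_mul (hU : IsMagicUnitary U) (hB : BlockInvariant U) (i j k : V) (a b c : W) :
    blockRight U k a c * U (i, a) (j, b) = if c = b then U (i, a) (j, b) else 0 := by
  rw [blockRight_eq hB k i, blockRight_self_mul hU]

/-- The row conditions come from the entries as row sums of blocks, the column conditions from the
same entries as column sums. -/
theorem blockRight_magic (hU : IsMagicUnitary U) (hB : BlockInvariant U) (i : V) :
    IsMagicUnitary (blockRight U i) where
  proj a b := isStarProjection_sum (fun _ => hU.proj _ _)
    fun j k h => hU.row_orthogonal _ _ _ fun e => h (congrArg Prod.fst e)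
  row_orthogonal a b c h := by
    rw [blockRight_apply, Finset.sum_mul]
    simp only [mul_blockRight_self hU, if_neg h, Finset.sum_const_zero]
  col_orthogonal a b c h := by
    rw [blockRight_eq_sum hB i i, blockRight_eq_sum hB i i, Finset.sum_mul_sum]
    refine Finset.sum_eq_zero fun k _ => Finset.sum_eq_zero fun l _ => ?_
    exact hU.col_orthogonal _ _ _ fun e => h (congrArg Prod.snd e)
  row_sum a := by
    simp only [blockRight_apply]
    rw [← Fintype.sum_prod_type_right (f := fun q => U (i, a) q), hU.row_sum]
  col_sum b := by
    simp only [blockRight_eq_sum hB i i]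
    rw [← Fintype.sum_prod_type_right (f := fun q => U q (i, b)), hU.col_sum]

/-- The factor `v a b` selects the term of index `b` in the sum defining `u^(a) i j`. With the
mirror identity below, this gives both the factorization of `U` and the commutation relation of the
free wreath product. -/
theorem blockLeft_mul_blockRight (hU : IsMagicUnitary U) (hB : BlockInvariant U) (i j k : V)
    (a b : W) : blockLeft U a i j * blockRight U k a b = U (i, a) (j, b) := by
  rw [blockLeft_apply, Finset.sum_mul]
  simp [mul_blockRight hU hB]

theorem blockRight_mul_blockLeft (hU : IsMagicUnitary U) (hB : BlockInvariant U) (i j k : V)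
    (a b : W) : blockRight U k a b * blockLeft U a i j = U (i, a) (j, b) := by
  rw [blockLeft_apply, Finset.mul_sum]
  simp [blockRight_mul hU hB]

theorem blockLeft_magic (hU : IsMagicUnitary U) (hB : BlockInvariant U) (a : W) :
    IsMagicUnitary (blockLeft U a) where
  proj i j := isStarProjection_sum (fun _ => hU.proj _ _)
    fun j k h => hU.row_orthogonal _ _ _ fun e => h (congrArg Prod.snd e)
  row_orthogonal i j k h := by
    rw [blockLeft_apply, blockLeft_apply, Finset.sum_mul_sum]
    refine Finset.sum_eq_zero fun b _ => Finset.sum_eq_zero fun c _ => ?_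
    exact hU.row_orthogonal _ _ _ fun e => h (congrArg Prod.fst e)
  col_orthogonal i j k h := by
    rw [blockLeft_apply, Finset.sum_mul]
    refine Finset.sum_eq_zero fun b _ => ?_
    -- Inserting `v a b` cuts `u^(a) k j` down to `U (k, a) (j, b)`, which lies in the same column
    -- as `U (i, a) (j, b)`; entries with different second column indices are not directly
    -- comparable.
    have h1 : U (i, a) (j, b) = U (i, a) (j, b) * blockRight U i a b := by
      rw [mul_blockRight hU hB, if_pos rfl]
    rw [h1, mul_assoc, blockRight_mul_blockLeft hU hB]
    exact hU.col_orthogonal _ _ _ fun e => h (congrArg Prod.fst e)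
  row_sum i := by
    simp only [blockLeft_apply]
    rw [← Fintype.sum_prod_type (f := fun q => U (i, a) q), hU.row_sum]
  col_sum j := by
    simp only [blockLeft_apply]
    -- Summing over `i` first produces column sums of blocks, which are the entries of row `a` of
    -- `v`.
    rw [Finset.sum_comm]
    simp only [← hB j j, ← blockRight_apply, (blockRight_magic hU hB j).row_sum]

/-! ### Commutation of the blocks with the adjacency matrices of the factors. -/

section Adjacency

open scoped Kronecker

/-- The two sides are the entries at `((i, a), (j, b))` of `U (J ⊗ 1)` and `(J ⊗ 1) U`. -/
theorem blockInvariant_of_mem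
    (h : allOnes V ⊗ₖ (1 : Matrix W W ℝ) ∈ realCentralizer U) : BlockInvariant U := by
  intro i j a b
  have h' := congrFun (congrFun (mem_realCentralizer.1 h).eq (i, a)) (j, b)
  simpa [Matrix.mul_apply, Fintype.sum_prod_type, allOnes, Matrix.one_apply, apply_ite] using h'.symm

theorem adjMatrix_map_algebraMap (X : SimpleGraph V) [DecidableRel X.Adj] :
    (X.adjMatrix ℝ).map (algebraMap ℝ A) = X.adjMatrix A := by
  ext i j
  by_cases h : X.Adj i j <;> simp [SimpleGraph.adjMatrix_apply, h]

/-- The relation with `d_X ⊗ 1` holds for each fixed `b` separately; summing it over `b` gives the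
claim. -/
theorem commute_blockLeft (X : SimpleGraph V) [DecidableRel X.Adj]
    (h : X.adjMatrix ℝ ⊗ₖ (1 : Matrix W W ℝ) ∈ realCentralizer U) (a : W) :
    Commute (X.adjMatrix A) (blockLeft U a) := by
  rw [commute_iff_eq]
  ext i j
  have h' : ∀ b, ∑ k, X.adjMatrix A i k * U (k, a) (j, b) =
      ∑ k, U (i, a) (k, b) * X.adjMatrix A k j := fun b => by
    have h' := congrFun (congrFun (mem_realCentralizer.1 h).eq (i, a)) (j, b)
    rw [Matrix.mul_apply, Matrix.mul_apply, Fintype.sum_prod_type, Fintype.sum_prod_type] at h'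
    simpa [-SimpleGraph.adjMatrix_apply, Matrix.one_apply, apply_ite,
      ← adjMatrix_map_algebraMap (A := A) X] using h'
  simp only [Matrix.mul_apply, blockLeft_apply, Finset.mul_sum, Finset.sum_mul]
  rw [Finset.sum_comm]
  refine Eq.trans ?_ Finset.sum_comm
  exact Finset.sum_congr rfl fun b _ => h' b

/-- In an entry of the relation with `J ⊗ d_Y`, the factor `J` produces column sums of blocks on one
side and row sums on the other; block invariance identifies both with entries of `v`. -/
theorem commute_blockRight (Y : SimpleGraph W) [DecidableRel Y.Adj] (hB : BlockInvariant U)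
    (h : allOnes V ⊗ₖ Y.adjMatrix ℝ ∈ realCentralizer U) (i : V) :
    Commute (Y.adjMatrix A) (blockRight U i) := by
  rw [commute_iff_eq]
  ext a b
  have h' := congrFun (congrFun (mem_realCentralizer.1 h).eq (i, a)) (i, b)
  rw [Matrix.mul_apply, Matrix.mul_apply, Fintype.sum_prod_type_right,
    Fintype.sum_prod_type_right] at h'
  rw [Matrix.mul_apply, Matrix.mul_apply, Finset.sum_congr rfl fun c _ =>
    congrArg (Y.adjMatrix A a c * ·) (blockRight_eq_sum hB i i c b)]
  simpa [-SimpleGraph.adjMatrix_apply, allOnes, blockRight_apply, Finset.mul_sum, Finset.sum_mul,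
    ← adjMatrix_map_algebraMap (A := A) Y] using h'

/-- A magic unitary with entries `u^(a) i j * v a b`, where all `u^(a)` commute with `d_X` and `v`
commutes with `d_Y`, commutes with the adjacency matrix of `X ∘ Y`. -/
theorem commute_adjMatrix_lexProd (X : SimpleGraph V) [DecidableRel X.Adj] (Y : SimpleGraph W)
    [DecidableRel Y.Adj] (u : W → Matrix V V A) (v : Matrix W W A)
    (hrow : ∀ a i, ∑ j, u a i j = 1) (hcol : ∀ a j, ∑ i, u a i j = 1)
    (hu : ∀ a, Commute (X.adjMatrix A) (u a)) (hv : Commute (Y.adjMatrix A) v) :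
    Commute ((lexProd X Y).adjMatrix A)
      (Matrix.of fun p q : V × W => u p.2 p.1 q.1 * v p.2 q.2) := by
  have hadj : (lexProd X Y).adjMatrix A = Matrix.of fun p q : V × W =>
      X.adjMatrix A p.1 q.1 * (if p.2 = q.2 then 1 else 0) + Y.adjMatrix A p.2 q.2 := by
    ext ⟨i, a⟩ ⟨j, b⟩
    rw [SimpleGraph.adjMatrix_apply]
    by_cases h : a = b
    · subst h
      simp [SimpleGraph.adjMatrix_apply, lexProd]
    · simp [SimpleGraph.adjMatrix_apply, lexProd, h]
  rw [commute_iff_eq, hadj]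
  ext ⟨i, a⟩ ⟨j, b⟩
  have h1 := congrFun (congrFun (hu a).eq i) j
  have h2 := congrFun (congrFun hv.eq a) b
  rw [Matrix.mul_apply, Matrix.mul_apply] at h1 h2
  -- The summand `d_X ⊗ 1` stays within one index `a`, where `u a` commutes with `d_X`; the
  -- coefficients are 0 or 1 and so pass through `v a b`.
  have e1 : ∑ k, X.adjMatrix A i k * (u a k j * v a b) =
      ∑ k, u a i k * v a b * X.adjMatrix A k j := by
    simp only [← mul_assoc, ← Finset.sum_mul, h1]
    rw [Finset.sum_mul]
    refine Finset.sum_congr rfl fun k _ => ?_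
    by_cases h : X.Adj k j <;> simp [SimpleGraph.adjMatrix_apply, h]
  -- For the summand `J ⊗ d_Y` the sum over `k` collapses `u` to 1, by column sums on the left and
  -- row sums on the right, leaving `d_Y v = v d_Y`.
  have e2 : ∑ k, ∑ c, Y.adjMatrix A a c * (u c k j * v c b) =
      ∑ k, ∑ c, u a i k * v a c * Y.adjMatrix A c b := by
    rw [Finset.sum_comm]
    simp only [mul_assoc, ← Finset.mul_sum, ← Finset.sum_mul, hcol, hrow, one_mul, h2]
  simp only [Matrix.mul_apply, Matrix.of_apply, Fintype.sum_prod_type, add_mul, mul_add,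
    Finset.sum_add_distrib, e2]
  congr 1
  simpa [-SimpleGraph.adjMatrix_apply] using e1

end Adjacency

end Blocks

/-! ### The isomorphism -/

/-- Comultiplication, counit and antipode are morphisms with prescribed values on the generating
entries, so matching entries forces compatibility with all three. -/
theorem QuantumPermGroup.iso_of_equiv {ι : Type} [Fintype ι] [DecidableEq ι]
    (P Q : QuantumPermGroup ι) (e : P.A ≃⋆ₐ[ℂ] Q.A) (h : ∀ i j, e (P.u i j) = Q.u i j) :
    Nonempty (P.Iso Q) := by
  let f : P.A →⋆ₐ[ℂ] Q.A := e
  have hf : ∀ i j, f (P.u i j) = Q.u i j := h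
  refine ⟨⟨e, h, fun x => ?_, fun x => ?_, fun x => ?_⟩⟩
  · refine DFunLike.congr_fun (P.hom_ext (φ := Q.comul.comp f)
      (ψ := (Tensor.map f f).comp P.comul) fun i j => ?_) x
    simp only [StarAlgHom.comp_apply, hf, P.comul_u, Q.comul_u, map_sum, Tensor.map_tmul]
  · refine DFunLike.congr_fun (P.hom_ext (φ := Q.counit.comp f) (ψ := P.counit) fun i j => ?_) x
    rw [StarAlgHom.comp_apply, hf, P.counit_u, Q.counit_u]
  · refine DFunLike.congr_fun (P.hom_ext (φ := Q.antipode.comp f)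
      (ψ := (Wreath.opHom f).comp P.antipode) fun i j => ?_) x
    rw [StarAlgHom.comp_apply, StarAlgHom.comp_apply, hf, P.antipode_u, Q.antipode_u]
    exact congrArg MulOpposite.op (hf j i).symm

theorem QuantumPermGroup.iso_of_hom {ι : Type} [Fintype ι] [DecidableEq ι]
    (P Q : QuantumPermGroup ι) (f : P.A →⋆ₐ[ℂ] Q.A) (g : Q.A →⋆ₐ[ℂ] P.A)
    (hf : ∀ i j, f (P.u i j) = Q.u i j) (hg : ∀ i j, g (Q.u i j) = P.u i j) :
    Nonempty (P.Iso Q) := by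
  refine P.iso_of_equiv Q (StarAlgEquiv.ofStarAlgHom f g ?_ ?_) hf
  · exact P.hom_ext fun i j => by rw [StarAlgHom.comp_apply, hf, hg]; rfl
  · exact Q.hom_ext fun i j => by rw [StarAlgHom.comp_apply, hg, hf]; rfl

/-- The universal property of `graphLift`, phrased through the fields of `quantumAut`. -/
theorem exists_hom_quantumAut {V A : Type} [Fintype V] [DecidableEq V] [CStarAlgebra A]
    (X : SimpleGraph V) [DecidableRel X.Adj] {v : Matrix V V A} (hv : IsMagicUnitary v)
    (hX : Commute (X.adjMatrix A) v) :
    ∃ φ : (quantumAut X).A →⋆ₐ[ℂ] A, ∀ i j, φ ((quantumAut X).u i j) = v i j :=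
  ⟨graphLift X v hv hX, graphLift_u X v hv hX⟩

theorem commute_quantumAut_u {V : Type} [Fintype V] [DecidableEq V] (X : SimpleGraph V)
    [DecidableRel X.Adj] : Commute (X.adjMatrix (quantumAut X).A) (quantumAut X).u :=
  graphU_commute X

theorem exists_hom_freeWreath {ι κ C : Type} [Fintype ι] [DecidableEq ι] [Nonempty ι] [Fintype κ]
    [DecidableEq κ] [CStarAlgebra C] (P : QuantumPermGroup ι) (Q : QuantumPermGroup κ)
    (φ : κ → P.A →⋆ₐ[ℂ] C) (ψ : Q.A →⋆ₐ[ℂ] C)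
    (h : ∀ i j a b, Commute (φ a (P.u i j)) (ψ (Q.u a b))) :
    ∃ g : (freeWreath P Q).A →⋆ₐ[ℂ] C, ∀ p q, g ((freeWreath P Q).u p q) =
      φ p.2 (P.u p.1 q.1) * ψ (Q.u p.2 q.2) := by
  refine ⟨Wreath.lift φ ψ h, fun p q => ?_⟩
  change Wreath.lift φ ψ h (Wreath.left P Q p.2 (P.u p.1 q.1) *
    Wreath.right P Q (Q.u p.2 q.2)) = _
  rw [map_mul, Wreath.lift_left, Wreath.lift_right]

theorem commute_freeWreath_u {V W : Type} [Fintype V] [DecidableEq V] [Nonempty V] [Fintype W]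
    [DecidableEq W] (X : SimpleGraph V) [DecidableRel X.Adj] (Y : SimpleGraph W)
    [DecidableRel Y.Adj] :
    Commute ((lexProd X Y).adjMatrix (freeWreath (quantumAut X) (quantumAut Y)).A)
      (freeWreath (quantumAut X) (quantumAut Y)).u := by
  let P := quantumAut X
  let Q := quantumAut Y
  have hl := fun a => P.magic.map (Wreath.left P Q a)
  exact commute_adjMatrix_lexProd X Y (fun a => P.u.map (Wreath.left P Q a))
    (Q.u.map (Wreath.right P Q)) (fun a => (hl a).row_sum) (fun a => (hl a).col_sum)
    (fun a => commute_map X _ (commute_quantumAut_u X)) (commute_map Y _ (commute_quantumAut_u Y))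

end QAut

theorem theorem6p2 {V W : Type} [Fintype V] [DecidableEq V] [Nonempty V] [Fintype W]
    [DecidableEq W] (X : SimpleGraph V) [DecidableRel X.Adj] (Y : SimpleGraph W)
    [DecidableRel Y.Adj] (valX valY : ℕ) (hX : X.IsRegularOfDegree valX)
    (hY : Y.IsRegularOfDegree valY) (hconn : X.Connected)
    (hspec : {x : ℝ | ∃ l ∈ spectrum ℝ (X.adjMatrix ℝ), l ≠ valX ∧ x = valX - l} ∩
      {x : ℝ | ∃ m ∈ spectrum ℝ (Y.adjMatrix ℝ), x = -(Fintype.card V * m)} = ∅) :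
    Nonempty (QAut.QuantumPermGroup.Iso (QAut.quantumAut (QAut.lexProd X Y))
      (QAut.freeWreath (QAut.quantumAut X) (QAut.quantumAut Y))) := by
  have hspec' : ∀ l ∈ spectrum ℝ (X.adjMatrix ℝ), l ≠ valX → ∀ m ∈ spectrum ℝ (Y.adjMatrix ℝ),
      (valX : ℝ) - l ≠ -(Fintype.card V * m) := fun l hl hne m hm h =>
    Set.eq_empty_iff_forall_notMem.1 hspec _ ⟨⟨l, hl, hne, rfl⟩, ⟨m, hm, h⟩⟩
  have hU := (QAut.quantumAut (QAut.lexProd X Y)).magic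
  have hmem : (QAut.lexProd X Y).adjMatrix ℝ ∈
      QAut.realCentralizer (QAut.quantumAut (QAut.lexProd X Y)).u := by
    rw [QAut.mem_realCentralizer, QAut.adjMatrix_map_algebraMap]
    exact QAut.commute_quantumAut_u _
  have hJ := QAut.allOnes_kronecker_one_mem X Y hX hconn hspec' hmem
  obtain ⟨hmX, hmY⟩ := QAut.adjMatrix_kronecker_mem X Y hX hmem hJ
  have hB := QAut.blockInvariant_of_mem hJ
  -- Any vertex will do, since `blockRight` does not depend on it under block invariance.
  let v : V := Classical.arbitrary V
  choose φ hφ using fun a => QAut.exists_hom_quantumAut X (QAut.blockLeft_magic hU hB a)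
    (QAut.commute_blockLeft X hmX a)
  obtain ⟨ψ, hψ⟩ := QAut.exists_hom_quantumAut Y (QAut.blockRight_magic hU hB v)
    (QAut.commute_blockRight Y hB hmY v)
  obtain ⟨f, hf⟩ := QAut.exists_hom_quantumAut (QAut.lexProd X Y)
    (QAut.freeWreath (QAut.quantumAut X) (QAut.quantumAut Y)).magic
    (QAut.commute_freeWreath_u X Y)
  obtain ⟨g, hg⟩ := QAut.exists_hom_freeWreath (QAut.quantumAut X) (QAut.quantumAut Y) φ ψ
    fun i j a b => by
      -- Both products equal the entry of the original magic unitary at `((i, a), (j, b))`.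
      rw [hφ, hψ, commute_iff_eq, QAut.blockLeft_mul_blockRight hU hB,
        QAut.blockRight_mul_blockLeft hU hB]
  refine QAut.QuantumPermGroup.iso_of_hom _ _ f g hf fun p q => ?_
  rw [hg, hφ, hψ, QAut.blockLeft_mul_blockRight hU hB]
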